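/- \textbf{Setting.} Consider a chain of three interconnected subsystems $$x(k+1)=Ax(k)+Bu(k)+w(k),\qquad x=(x_1,x_2,x_3),\ u=(u_1,u_2,u_3),\qquad k=0,\dots,N-1,\ N\ge 1,$$ where $A$ is block tridiagonal ($A_{13}=0$, $A_{31}=0$) and $B$ is block diagonal, with arbitrary block sizes. The initial state $x(0)$ and the noise vectors $w(0),w(1),\dots$ have zero mean and finite second moments and are mutually uncorrelated, $x(0)$ has covariance $P_0$, and each $w(k)$ has covariance $W$ (for example, Gaussian white noise). An admissible controller is a linear law in which $u_i(k)$ is a linear function of the information available to subsystem $i$ at time $k$, namely $x_i(k)$, the $x_j(k-1)$ with $|i-j|\le 1$, and $x(0),\dots,x(k-2)$. Thus $$u(k)=F(k)x(k)+G(k)x(k-1)+f_k\bigl(x(0),\dots,x(k-2)\bigr)$$ with $F(k)$ block diagonal, $G(k)$ block tridiagonal and $f_k$ an arbitrary linear map. Put $M(k)=F(k)\bigl(A+BF(k-1)\bigr)+G(k)$ for $k\ge1$. The finite-horizon problem is to minimize, over all admissible controllers, $$J=\mathbf E\{x(N)^TQ_0x(N)\}+\sum_{k=0}^{N-1}\mathbf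 E\{x(k)^TQx(k)+u(k)^TRu(k)\}.$$ Let $X(N)=Q_0$ and, for $k=N-1,\dots,0$, $$H(k)=B^TX(k+1)B+R,\qquad L(k)=-H(k)^{-1}B^TX(k+1)A,$$ $$X(k)=A^TX(k+1)A+Q-A^TX(k+1)B\,H(k)^{-1}B^TX(k+1)A .$$ For $1\le k\le N$ let $\Sigma_k$ be the covariance of $w(k-2)$ with the convention $w(-1)=x(0)$; that is, $\Sigma_1=P_0$ and $\Sigma_k=W$ for $k\ge2$ (so $\Sigma_k=W$ for all $k$ if $P_0=W$). For $1\le k\le N-1$ let $$Y_k=\begin{bmatrix}\Sigma_k\otimes\bigl(H(k-1)+B^TL(k)^TH(k)L(k)B\bigr)&-\Sigma_k\otimes B^TL(k)^TH(k)\\-\Sigma_k\otimes H(k)L(k)B&\Sigma_k\otimes H(k)\end{bmatrix},$$ $$b_k=\begin{bmatrix}\Sigma_k\otimes H(k-1)\\0\end{bmatrix}\mathrm{vec}(L(k-1))+\begin{bmatrix}-\Sigma_k\otimes B^TL(k)^TH(k)\\\Sigma_k\otimes H(k)\end{bmatrix}\mathrm{vec}(L(k)A),$$ and let $Y_N=\Sigma_N\otimes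 H(N-1)$, $b_N=Y_N\,\mathrm{vec}(L(N-1))$. Put $D(k)=[F(k-1)\ \ M(k)]$ for $1\le k\le N-1$ and $D(N)=F(N-1)$. Let $S$ be the set of those indices of $\mathrm{vec}(D(k))$ that the sparsity pattern allows to be nonzero (block diagonal pattern for $F$, block tridiagonal pattern for $M$), and let $\mathrm{vec}^\star$ denote the subvector of $\mathrm{vec}$ at the allowed indices. \textbf{Theorem 3 (finite horizon optimal gains).} Suppose that $W\succ0$, that $Q_0,Q\succeq0$ and that $R\succ0$. Then an optimal admissible controller exists. For every $1\le k\le N$, where for $k=1$ it is also supposed that $P_0\succ0$, the matrix $[Y_k]_{SS}$ is nonsingular, and the gains of every optimal admissible controller satisfy $$\mathrm{vec}^\star(D(k))=[Y_k]_{SS}^{-1}[b_k]_S .$$ Here, for $k\le N-1$, $\mathrm{vec}^\star(F(k-1))$ and $\mathrm{vec}^\star(M(k))$ are the first and the second block of this vector, while $\mathrm{vec}^\star(F(N-1))=\mathrm{vec}^\star(D(N))$. The remaining entries of $F(k-1)$ and $M(k)$ are zero. -/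

import Mathlib

open MeasureTheory ProbabilityTheory
open scoped Matrix Kronecker

noncomputable section

namespace DelayedLQ

/-- Scalar coordinates of a stacked vector `(v₁, v₂, v₃)` whose `i`-th block has size `d i`. -/
abbrev Idx (d : Fin 3 → ℕ) : Type := (i : Fin 3) × Fin (d i)

/-- Two subsystems of the chain `1 - 2 - 3` are equal or neighbours. -/
def Near (i j : Fin 3) : Prop := (i : ℕ) ≤ (j : ℕ) + 1 ∧ (j : ℕ) ≤ (i : ℕ) + 1

instance (i j : Fin 3) : Decidable (Near i j) := by unfold Near; infer_instance

/-- Block diagonal pattern: only blocks `(i, i)` may be nonzero. -/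
def BlockDiag {r c : Fin 3 → ℕ} (T : Matrix (Idx r) (Idx c) ℝ) : Prop :=
  ∀ a b, a.1 ≠ b.1 → T a b = 0

/-- Block tridiagonal pattern: only blocks `(i, j)` with `|i - j| ≤ 1` may be nonzero. -/
def BlockTridiag {r c : Fin 3 → ℕ} (T : Matrix (Idx r) (Idx c) ℝ) : Prop :=
  ∀ a b, ¬ Near a.1 b.1 → T a b = 0

/-! ### The stochastic system and the control problem -/

/-- Second-order description of the primitive random vectors: the initial state `x0` and the noise
`w 0, w 1, …` have zero mean and finite second moments, `x0` has covariance `P0`, every `w k` has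
covariance `W`, and all these vectors are mutually uncorrelated. -/
structure IsNoise {Ω : Type*} [MeasurableSpace Ω] (μ : Measure Ω) {n : Fin 3 → ℕ}
    (P0 W : Matrix (Idx n) (Idx n) ℝ) (x0 : Ω → Idx n → ℝ) (w : ℕ → Ω → Idx n → ℝ) : Prop where
  memLp_init : ∀ a, MemLp (fun ω => x0 ω a) 2 μ
  memLp_noise : ∀ k a, MemLp (fun ω => w k ω a) 2 μ
  mean_init : ∀ a, ∫ ω, x0 ω a ∂μ = 0
  mean_noise : ∀ k a, ∫ ω, w k ω a ∂μ = 0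
  cov_init : ∀ a b, cov[fun ω => x0 ω a, fun ω => x0 ω b; μ] = P0 a b
  cov_noise : ∀ k a b, cov[fun ω => w k ω a, fun ω => w k ω b; μ] = W a b
  cov_noise_noise : ∀ k l, k ≠ l → ∀ a b, cov[fun ω => w k ω a, fun ω => w l ω b; μ] = 0
  cov_init_noise : ∀ k a b, cov[fun ω => x0 ω a, fun ω => w k ω b; μ] = 0

/-- A causal linear control law: at time `k` the input is `u(k) = ∑_{j ≤ k} K k j x(j)`. -/
abbrev Law (n m : Fin 3 → ℕ) : Type := ℕ → ℕ → Matrix (Idx m) (Idx n) ℝ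

/-- `Knows i k j l`: the component `x_l(j)` belongs to the information set of subsystem `i` at
time `k`. -/
def Knows (i : Fin 3) (k j : ℕ) (l : Fin 3) : Prop :=
  (j = k ∧ l = i) ∨ (j + 1 = k ∧ Near i l) ∨ j + 2 ≤ k

/-- Every `u_i(k)` is a linear function of the information set of subsystem `i` at time `k`. -/
def Admissible {n m : Fin 3 → ℕ} (K : Law n m) : Prop :=
  ∀ (k j : ℕ) (a : Idx m) (b : Idx n), ¬ Knows a.1 k j b.1 → K k j a b = 0

section ControlProblem

variable {n m : Fin 3 → ℕ}
variable (A : Matrix (Idx n) (Idx n) ℝ) (B : Matrix (Idx n) (Idx m) ℝ)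

/-- The closed-loop state for the law `K`, along one realization of the initial state and noise. -/
def state (K : Law n m) (x0 : Idx n → ℝ) (w : ℕ → Idx n → ℝ) : ℕ → Idx n → ℝ
  | 0 => x0
  | k + 1 => A *ᵥ state K x0 w k
      + B *ᵥ (∑ j : Fin (k + 1), K k j *ᵥ state K x0 w j) + w k
termination_by k => k
decreasing_by
  · exact Nat.lt_succ_self k
  · exact j.2

/-- The closed-loop input for the law `K`. -/
def input (K : Law n m) (x0 : Idx n → ℝ) (w : ℕ → Idx n → ℝ) (k : ℕ) : Idx m → ℝ :=
  ∑ j : Fin (k + 1), K k j *ᵥ state A B K x0 w j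

variable (Q0 Q : Matrix (Idx n) (Idx n) ℝ) (R : Matrix (Idx m) (Idx m) ℝ) (N : ℕ)

/-- The cost `J = E[x(N)ᵀ Q₀ x(N)] + ∑_{k < N} E[x(k)ᵀ Q x(k) + u(k)ᵀ R u(k)]`. -/
def cost {Ω : Type*} [MeasurableSpace Ω] (μ : Measure Ω)
    (x0 : Ω → Idx n → ℝ) (w : ℕ → Ω → Idx n → ℝ) (K : Law n m) : ℝ :=
  let x : ℕ → Ω → Idx n → ℝ := fun k ω => state A B K (x0 ω) (fun j => w j ω) k
  let u : ℕ → Ω → Idx m → ℝ := fun k ω => input A B K (x0 ω) (fun j => w j ω) k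
  (∫ ω, x N ω ⬝ᵥ (Q0 *ᵥ x N ω) ∂μ)
    + ∑ k ∈ Finset.range N,
        ∫ ω, (x k ω ⬝ᵥ (Q *ᵥ x k ω) + u k ω ⬝ᵥ (R *ᵥ u k ω)) ∂μ

/-- `K` is admissible and minimizes the cost among all admissible laws. -/
def IsOptimal {Ω : Type*} [MeasurableSpace Ω] (μ : Measure Ω)
    (x0 : Ω → Idx n → ℝ) (w : ℕ → Ω → Idx n → ℝ) (K : Law n m) : Prop :=
  Admissible K ∧ ∀ K' : Law n m, Admissible K' →
    cost A B Q0 Q R N μ x0 w K ≤ cost A B Q0 Q R N μ x0 w K'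

/-! ### Gains of a law: `u(k) = F(k) x(k) + G(k) x(k-1) + f(x(0:k-2))` -/

/-- The gain `F(k)` on the current state. -/
def gainF (K : Law n m) (k : ℕ) : Matrix (Idx m) (Idx n) ℝ := K k k

/-- The gain `G(k)` on the previous state (used for `k ≥ 1`). -/
def gainG (K : Law n m) (k : ℕ) : Matrix (Idx m) (Idx n) ℝ := K k (k - 1)

/-- `M(k) = F(k) (A + B F(k-1)) + G(k)` (used for `k ≥ 1`). -/
def gainM (K : Law n m) (k : ℕ) : Matrix (Idx m) (Idx n) ℝ :=
  gainF K k * (A + B * gainF K (k - 1)) + gainG K k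

/-! ### Riccati recursion -/

/-- The Riccati recursion run backwards: `riccatiRev j = X(N - j)`, started at `X(N) = Q₀`. -/
def riccatiRev : ℕ → Matrix (Idx n) (Idx n) ℝ
  | 0 => Q0
  | j + 1 =>
      let X := riccatiRev j
      Aᵀ * X * A + Q - (Aᵀ * X * B) * (Bᵀ * X * B + R)⁻¹ * (Bᵀ * X * A)

/-- `X(k)` for `0 ≤ k ≤ N`. -/
def ricX (k : ℕ) : Matrix (Idx n) (Idx n) ℝ := riccatiRev A B Q0 Q R (N - k)

/-- `H(k) = Bᵀ X(k+1) B + R` for `0 ≤ k < N`. -/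
def ricH (k : ℕ) : Matrix (Idx m) (Idx m) ℝ := Bᵀ * ricX A B Q0 Q R N (k + 1) * B + R

/-- The gain `L(k) = -(Bᵀ X(k+1) B + R)⁻¹ Bᵀ X(k+1) A` for `0 ≤ k < N`; with this sign the
centralized optimal feedback is `u(k) = L(k) x(k)`. -/
def ricL (k : ℕ) : Matrix (Idx m) (Idx n) ℝ :=
  -((Bᵀ * ricX A B Q0 Q R N (k + 1) * B + R)⁻¹ * (Bᵀ * ricX A B Q0 Q R N (k + 1) * A))

end ControlProblem

/-! ### Vectorization and sparsity

`Matrix.vec T` is the column stacking of `T`, indexed by (column, row). -/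

/-- Index set of the structurally nonzero entries of `vec F`. -/
def SF (n m : Fin 3 → ℕ) : Finset (Idx n × Idx m) :=
  Finset.univ.filter fun p => p.1.1 = p.2.1

/-- Index set of the structurally nonzero entries of `vec M` (same pattern as `G`). -/
def SM (n m : Fin 3 → ℕ) : Finset (Idx n × Idx m) :=
  Finset.univ.filter fun p => Near p.2.1 p.1.1

/-- Index set of the structurally nonzero entries of `vec [F M]`. -/
def SD (n m : Fin 3 → ℕ) : Finset ((Idx n × Idx m) ⊕ (Idx n × Idx m)) :=
  (SF n m).disjSum (SM n m)

/-- The subvector `[v]_S`. -/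
def subVec {ι : Type*} (S : Finset ι) (v : ι → ℝ) : S → ℝ := fun i => v i

/-- The submatrix `[Y]_{SS}`. -/
def subMat {ι : Type*} (S : Finset ι) (Y : Matrix ι ι ℝ) : Matrix S S ℝ :=
  Y.submatrix Subtype.val Subtype.val

/-- `vec [F M]`, its index set being written as two consecutive blocks. -/
def vecD {n m : Fin 3 → ℕ} (D : Matrix (Idx m) (Idx n ⊕ Idx n) ℝ) :
    (Idx n × Idx m) ⊕ (Idx n × Idx m) → ℝ :=
  fun p => Matrix.vec D ((Equiv.sumProdDistrib (Idx n) (Idx n) (Idx m)).symm p)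

/-- The first block `[I 0] v` of a vector indexed by `SD`. -/
def firstBlock {n m : Fin 3 → ℕ} (v : SD n m → ℝ) : SF n m → ℝ :=
  fun i => v ⟨Sum.inl i.1, Finset.inl_mem_disjSum.2 i.2⟩

/-- The second block `[0 I] v` of a vector indexed by `SD`. -/
def secondBlock {n m : Fin 3 → ℕ} (v : SD n m → ℝ) : SM n m → ℝ :=
  fun i => v ⟨Sum.inr i.1, Finset.inr_mem_disjSum.2 i.2⟩

section Data

variable {n m : Fin 3 → ℕ}
variable (A : Matrix (Idx n) (Idx n) ℝ) (B : Matrix (Idx n) (Idx m) ℝ)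
variable (Q0 Q : Matrix (Idx n) (Idx n) ℝ) (R : Matrix (Idx m) (Idx m) ℝ) (N : ℕ)
variable (P0 W : Matrix (Idx n) (Idx n) ℝ)

/-- Covariance of `w(k-2)` for `k ≥ 1`, where `w(-1)` stands for the initial state `x(0)`. -/
def noiseCov (k : ℕ) : Matrix (Idx n) (Idx n) ℝ := if k = 1 then P0 else W

/-- The matrix `Y_k`, for `1 ≤ k ≤ N - 1`. -/
def Ymat (k : ℕ) :
    Matrix ((Idx n × Idx m) ⊕ (Idx n × Idx m)) ((Idx n × Idx m) ⊕ (Idx n × Idx m)) ℝ :=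
  let C := noiseCov P0 W k
  let H := ricH A B Q0 Q R N
  let L := ricL A B Q0 Q R N
  let Y11 := C ⊗ₖ (H (k - 1) + Bᵀ * (L k)ᵀ * H k * L k * B)
  let Y12 := -(C ⊗ₖ (Bᵀ * (L k)ᵀ * H k))
  let Y22 := C ⊗ₖ H k
  Matrix.fromBlocks Y11 Y12 Y12ᵀ Y22

/-- The vector `b_k`, for `1 ≤ k ≤ N - 1`. -/
def bvec (k : ℕ) : (Idx n × Idx m) ⊕ (Idx n × Idx m) → ℝ :=
  let C := noiseCov P0 W k
  let H := ricH A B Q0 Q R N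
  let L := ricL A B Q0 Q R N
  Sum.elim ((C ⊗ₖ H (k - 1)) *ᵥ Matrix.vec (L (k - 1))) 0
    + Sum.elim ((-(C ⊗ₖ (Bᵀ * (L k)ᵀ * H k))) *ᵥ Matrix.vec (L k * A))
        ((C ⊗ₖ H k) *ᵥ Matrix.vec (L k * A))

/-- The matrix `Y_N`. -/
def Ylast : Matrix (Idx n × Idx m) (Idx n × Idx m) ℝ :=
  noiseCov P0 W N ⊗ₖ ricH A B Q0 Q R N (N - 1)

/-- The vector `b_N`. -/
def blast : Idx n × Idx m → ℝ :=
  Ylast A B Q0 Q R N P0 W *ᵥ Matrix.vec (ricL A B Q0 Q R N (N - 1))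

/-- `[Y_k]_{SS}⁻¹ [b_k]_S` for `1 ≤ k ≤ N - 1`. -/
def sol (k : ℕ) : SD n m → ℝ :=
  (subMat (SD n m) (Ymat A B Q0 Q R N P0 W k))⁻¹ *ᵥ
    subVec (SD n m) (bvec A B Q0 Q R N P0 W k)

/-- `[Y_N]_{SS}⁻¹ [b_N]_S`. -/
def solLast : SF n m → ℝ :=
  (subMat (SF n m) (Ylast A B Q0 Q R N P0 W))⁻¹ *ᵥ
    subVec (SF n m) (blast A B Q0 Q R N P0 W)

end Data

end DelayedLQ

end

namespace DelayedLQ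

/-! ### Weighted least squares with a prescribed support. -/

section LeastSquares

variable {ι κ : Type*} [Fintype ι] [Fintype κ]

/-! Expand the closed loop in the uncorrelated disturbances `d_0 = x(0)`, `d_{j+1} = w(j)`: the
input is `u(k) = ∑ Γ(k,j) d_j` and the state is `x(k) = ∑ Φ(k,j) d_j`, with `Γ(j,j) = F(j)` and
`Γ(j+1,j) = M(j+1)`. Admissibility makes these two block diagonal and block tridiagonal. Conversely,
every causal `Γ` with these two patterns comes from an admissible law (`realize`,
`admissible_realize`, `input_realize`); the `Γ(k,j)` with `k ≥ j+2` are free, because data two steps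
old are known to every subsystem.

Uncorrelatedness turns the cost into a sum of traces over `j`. Completing squares along the Riccati
recursion (`ricX_step`, `cost_eq_base_add_excess`) leaves a constant plus quadratic forms in `Γ(k,j)
- L(k) Φ(k,j)`, weighted by `H(k)` and the covariance of `d_j`. The forms with `k ≥ j+2` are
nonnegative and vanish under the centralized feedback. Those with `k = j` and `k = j+1` involve only
`F(j)` and `M(j+1)`, since `Φ(j,j) = 1` and `Φ(j+1,j) = A + B F(j)`.

So the problem decouples into one sparse least squares problem per disturbance, whose normal
equations are given by `Y_{j+1}` and `b_{j+1}`. The lower bound `nearCost_le_cost` and its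
attainment `exists_admissible_cost_eq` yield existence, and force every optimal law to solve each of
these problems. -/

theorem exists_transpose_mul_self_eq {P : Matrix ι ι ℝ} (hP : P.PosSemidef) :
    ∃ S : Matrix ι ι ℝ, P = Sᵀ * S := by
  classical
  open scoped MatrixOrder in
  obtain ⟨S, hS⟩ := CStarAlgebra.nonneg_iff_eq_star_mul_self.1 hP.nonneg
  exact ⟨S, by simpa [Matrix.star_eq_conjTranspose] using hS⟩

/-- The range of `Gᵀ * G` lies in that of `Gᵀ`, and the ranks agree, so the ranges coincide. -/
theorem exists_transpose_mul_self_mulVec_eq (G : Matrix ι κ ℝ) (z : ι → ℝ) :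
    ∃ d, (Gᵀ * G) *ᵥ d = Gᵀ *ᵥ z := by
  have hle : LinearMap.range (Gᵀ * G).mulVecLin ≤ LinearMap.range Gᵀ.mulVecLin := by
    rintro _ ⟨d, rfl⟩
    exact ⟨G *ᵥ d, by simp⟩
  have heq := Submodule.eq_of_le_of_finrank_eq hle (by
    have h := Matrix.rank_transpose_mul_self G
    rw [← Matrix.rank_transpose G] at h
    exact h)
  have : Gᵀ *ᵥ z ∈ LinearMap.range (Gᵀ * G).mulVecLin := heq ▸ ⟨z, Matrix.mulVecLin_apply _ _⟩
  obtain ⟨d, hd⟩ := this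
  exact ⟨d, hd⟩

/-- The weighted least squares objective `(T d - y)ᵀ P (T d - y)`. -/
def lsq (P : Matrix ι ι ℝ) (T : Matrix ι κ ℝ) (y : ι → ℝ) (d : κ → ℝ) : ℝ :=
  (T *ᵥ d - y) ⬝ᵥ (P *ᵥ (T *ᵥ d - y))

/-- Solvability for a singular weight is what gives existence of an optimal law when `P0` is
singular. -/
theorem exists_normal_eq {P : Matrix ι ι ℝ} (hP : P.PosSemidef) (T : Matrix ι κ ℝ) (y : ι → ℝ) :
    ∃ d, (Tᵀ * P * T) *ᵥ d = (Tᵀ * P) *ᵥ y := by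
  obtain ⟨S, rfl⟩ := exists_transpose_mul_self_eq hP
  obtain ⟨d, hd⟩ := exists_transpose_mul_self_mulVec_eq (S * T) (S *ᵥ y)
  refine ⟨d, ?_⟩
  simpa [Matrix.mul_assoc, Matrix.transpose_mul] using hd

/-- Pythagoras: the normal equation says that the residual at `d₀` is `P`-orthogonal to the range of
`T`, so the cross terms vanish. -/
theorem lsq_eq_of_normal_eq {P : Matrix ι ι ℝ} (hP : Pᵀ = P) {T : Matrix ι κ ℝ} {y : ι → ℝ}
    {d₀ : κ → ℝ} (h₀ : (Tᵀ * P * T) *ᵥ d₀ = (Tᵀ * P) *ᵥ y) (d : κ → ℝ) :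
    lsq P T y d = lsq P T y d₀ + (d - d₀) ⬝ᵥ ((Tᵀ * P * T) *ᵥ (d - d₀)) := by
  set e := d - d₀ with he
  set r := T *ᵥ d₀ - y with hr
  have hd : T *ᵥ d - y = r + T *ᵥ e := by
    rw [hr, he, Matrix.mulVec_sub]; abel
  have hr0 : Tᵀ *ᵥ (P *ᵥ r) = 0 := by
    rw [hr, Matrix.mulVec_sub, Matrix.mulVec_sub, sub_eq_zero]
    simpa [Matrix.mulVec_mulVec, Matrix.mul_assoc] using h₀
  have h1 : (T *ᵥ e) ⬝ᵥ (P *ᵥ r) = 0 := by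
    rw [dotProduct_comm, Matrix.dotProduct_mulVec, ← Matrix.mulVec_transpose, hr0, zero_dotProduct]
  have h2 : r ⬝ᵥ (P *ᵥ (T *ᵥ e)) = 0 := by
    rw [Matrix.dotProduct_mulVec, ← Matrix.mulVec_transpose, hP, dotProduct_comm, h1]
  have h3 : (T *ᵥ e) ⬝ᵥ (P *ᵥ (T *ᵥ e)) = e ⬝ᵥ ((Tᵀ * P * T) *ᵥ e) := by
    rw [Matrix.mul_assoc, ← Matrix.mulVec_mulVec, ← Matrix.mulVec_mulVec,
      Matrix.dotProduct_mulVec e, Matrix.vecMul_transpose]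
  unfold lsq
  rw [hd, Matrix.mulVec_add, add_dotProduct, dotProduct_add, dotProduct_add, h1, h2, h3]
  ring

omit [Fintype ι] in
theorem transpose_eq_of_posSemidef {P : Matrix ι ι ℝ} (hP : P.PosSemidef) : Pᵀ = P := by
  simpa using hP.isHermitian.eq

theorem exists_lsq_min {P : Matrix ι ι ℝ} (hP : P.PosSemidef) (T : Matrix ι κ ℝ) (y : ι → ℝ) :
    ∃ d₀, ∀ d, lsq P T y d₀ ≤ lsq P T y d := by
  obtain ⟨d₀, h₀⟩ := exists_normal_eq hP T y
  refine ⟨d₀, fun d => ?_⟩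
  rw [lsq_eq_of_normal_eq (transpose_eq_of_posSemidef hP) h₀ d]
  have := (hP.conjTranspose_mul_mul_same T).dotProduct_mulVec_nonneg (d - d₀)
  simpa using this

theorem eq_of_lsq_min [DecidableEq κ] {P : Matrix ι ι ℝ} (hP : P.PosSemidef) {T : Matrix ι κ ℝ}
    {y : ι → ℝ} (hY : (Tᵀ * P * T).PosDef) {d : κ → ℝ} (hd : ∀ d', lsq P T y d ≤ lsq P T y d') :
    d = (Tᵀ * P * T)⁻¹ *ᵥ ((Tᵀ * P) *ᵥ y) := by
  set d₀ := (Tᵀ * P * T)⁻¹ *ᵥ ((Tᵀ * P) *ᵥ y)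
  have h₀ : (Tᵀ * P * T) *ᵥ d₀ = (Tᵀ * P) *ᵥ y := by
    rw [Matrix.mulVec_mulVec, Matrix.mul_nonsing_inv _ ((Matrix.isUnit_iff_isUnit_det _).1 hY.isUnit),
      Matrix.one_mulVec]
  have h := hd d₀
  rw [lsq_eq_of_normal_eq (transpose_eq_of_posSemidef hP) h₀ d] at h
  by_contra hne
  have := hY.dotProduct_mulVec_pos (sub_ne_zero.2 hne)
  rw [star_trivial] at this
  linarith

omit [Fintype ι] in
theorem submatrix_val_mulVec_subVec (S : Finset κ) (T : Matrix ι κ ℝ) {v : κ → ℝ}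
    (hv : ∀ i ∉ S, v i = 0) : T.submatrix id (Subtype.val : S → κ) *ᵥ subVec S v = T *ᵥ v := by
  ext i
  simp only [Matrix.mulVec, dotProduct, Matrix.submatrix_apply, id, subVec]
  rw [Finset.sum_coe_sort S (fun j => T i j * v j)]
  exact Finset.sum_subset (Finset.subset_univ S) fun j _ hj => by rw [hv j hj, mul_zero]

theorem lsq_submatrix (S : Finset κ) (P : Matrix ι ι ℝ) (T : Matrix ι κ ℝ) (y : ι → ℝ) {v : κ → ℝ}
    (hv : ∀ i ∉ S, v i = 0) :
    lsq P (T.submatrix id (Subtype.val : S → κ)) y (subVec S v) = lsq P T y v := by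
  unfold lsq
  rw [submatrix_val_mulVec_subVec S T hv]

omit [Fintype κ] in
theorem exists_subVec_eq (S : Finset κ) (d : S → ℝ) :
    ∃ v : κ → ℝ, (∀ i ∉ S, v i = 0) ∧ subVec S v = d := by
  classical
  refine ⟨fun i => if h : i ∈ S then d ⟨i, h⟩ else 0, fun i hi => by simp [hi], ?_⟩
  ext i
  simp [subVec]

theorem exists_masked_lsq_min {P : Matrix ι ι ℝ} (hP : P.PosSemidef) (T : Matrix ι κ ℝ)
    (y : ι → ℝ) (S : Finset κ) :
    ∃ v, (∀ i ∉ S, v i = 0) ∧ ∀ v', (∀ i ∉ S, v' i = 0) → lsq P T y v ≤ lsq P T y v' := by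
  obtain ⟨d, hd⟩ := exists_lsq_min hP (T.submatrix id (Subtype.val : S → κ)) y
  obtain ⟨v, hv, rfl⟩ := exists_subVec_eq S d
  refine ⟨v, hv, fun v' hv' => ?_⟩
  have := hd (subVec S v')
  rwa [lsq_submatrix S P T y hv, lsq_submatrix S P T y hv'] at this

/-- Imposing the support `S` amounts to deleting the other columns of `T`; this replaces the normal
matrix by its principal submatrix, which stays positive definite, and the right-hand side by its
subvector. -/
theorem subVec_eq_of_masked_lsq_min [DecidableEq κ] {P : Matrix ι ι ℝ} (hP : P.PosSemidef)
    {T : Matrix ι κ ℝ} {y : ι → ℝ} (S : Finset κ) (hY : (Tᵀ * P * T).PosDef) {v : κ → ℝ}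
    (hv : ∀ i ∉ S, v i = 0) (hmin : ∀ v', (∀ i ∉ S, v' i = 0) → lsq P T y v ≤ lsq P T y v') :
    subVec S v = (subMat S (Tᵀ * P * T))⁻¹ *ᵥ subVec S ((Tᵀ * P) *ᵥ y) := by
  have hsub : (T.submatrix id (Subtype.val : S → κ))ᵀ * P * T.submatrix id (Subtype.val : S → κ)
      = subMat S (Tᵀ * P * T) := by
    ext i j
    simp [subMat, Matrix.mul_apply]
  have hvec : ((T.submatrix id (Subtype.val : S → κ))ᵀ * P) *ᵥ y = subVec S ((Tᵀ * P) *ᵥ y) := by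
    ext i
    simp [subVec, Matrix.mulVec, dotProduct, Matrix.mul_apply]
  rw [← hsub, ← hvec]
  refine eq_of_lsq_min hP ?_ fun d' => ?_
  · rw [hsub]
    exact hY.submatrix Subtype.val_injective
  · obtain ⟨v', hv', rfl⟩ := exists_subVec_eq S d'
    rw [lsq_submatrix S P T y hv, lsq_submatrix S P T y hv']
    exact hmin v' hv'

omit [Fintype κ] in
theorem isUnit_det_subMat [DecidableEq κ] (S : Finset κ) {Y : Matrix κ κ ℝ} (hY : Y.PosDef) :
    IsUnit (subMat S Y).det :=
  (Matrix.isUnit_iff_isUnit_det _).1 (hY.submatrix Subtype.val_injective).isUnit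

theorem posSemidef_fromBlocks_diag {P₁ : Matrix ι ι ℝ} {P₂ : Matrix κ κ ℝ} (h₁ : P₁.PosSemidef)
    (h₂ : P₂.PosSemidef) : (Matrix.fromBlocks P₁ 0 0 P₂).PosSemidef := by
  refine Matrix.PosSemidef.of_dotProduct_mulVec_nonneg ?_ fun x => ?_
  · exact Matrix.isHermitian_fromBlocks_iff.2 ⟨h₁.isHermitian, by simp, by simp, h₂.isHermitian⟩
  · have e₁ := h₁.dotProduct_mulVec_nonneg (x ∘ Sum.inl)
    have e₂ := h₂.dotProduct_mulVec_nonneg (x ∘ Sum.inr)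
    rw [star_trivial] at e₁ e₂ ⊢
    rw [← Sum.elim_comp_inl_inr x, Matrix.fromBlocks_mulVec]
    simp only [sumElim_dotProduct_sumElim]
    simpa using add_nonneg e₁ e₂

theorem posDef_fromBlocks_diag {P₁ : Matrix ι ι ℝ} {P₂ : Matrix κ κ ℝ} (h₁ : P₁.PosDef)
    (h₂ : P₂.PosDef) : (Matrix.fromBlocks P₁ 0 0 P₂).PosDef := by
  classical
  refine ((posSemidef_fromBlocks_diag h₁.posSemidef h₂.posSemidef).posDef_iff_isUnit).2 ?_
  rw [Matrix.isUnit_iff_isUnit_det, Matrix.det_fromBlocks_zero₂₁]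
  exact ((Matrix.isUnit_iff_isUnit_det _).1 h₁.isUnit).mul ((Matrix.isUnit_iff_isUnit_det _).1 h₂.isUnit)

end LeastSquares

/-! ### The least squares problem attached to one disturbance. -/

section Stage

variable {n m : Fin 3 → ℕ}

/-- The quadratic form `tr(Cᵀ H C V)`, i.e. `E (C v)ᵀ H (C v)` for `v` with second moment `V`. -/
def wtr {α β : Type*} [Fintype α] [Fintype β] (H : Matrix α α ℝ) (V : Matrix β β ℝ)
    (C : Matrix α β ℝ) : ℝ := (Cᵀ * H * C * V).trace

theorem vec_dotProduct_kronecker_mulVec_vec {α β : Type*} [Fintype α] [Fintype β]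
    (H : Matrix α α ℝ) {V : Matrix β β ℝ} (hV : Vᵀ = V) (C : Matrix α β ℝ) :
    Matrix.vec C ⬝ᵥ ((V ⊗ₖ H) *ᵥ Matrix.vec C) = wtr H V C := by
  rw [Matrix.kronecker_mulVec_vec, Matrix.vec_dotProduct_vec, hV, wtr]
  simp only [Matrix.mul_assoc]

theorem wtr_nonneg {α β : Type*} [Fintype α] [Fintype β] {H : Matrix α α ℝ} {V : Matrix β β ℝ}
    (hH : H.PosSemidef) (hV : V.PosSemidef) (C : Matrix α β ℝ) : 0 ≤ wtr H V C := by
  classical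
  rw [← vec_dotProduct_kronecker_mulVec_vec H (transpose_eq_of_posSemidef hV) C]
  simpa using (hV.kronecker hH).dotProduct_mulVec_nonneg (Matrix.vec C)

/-- The matrix of the linear map `(vec F, vec M) ↦ (vec F, vec (M - L B F))`. -/
def stageT (B : Matrix (Idx n) (Idx m) ℝ) (L : Matrix (Idx m) (Idx n) ℝ) :
    Matrix ((Idx n × Idx m) ⊕ (Idx n × Idx m)) ((Idx n × Idx m) ⊕ (Idx n × Idx m)) ℝ :=
  Matrix.fromBlocks 1 0 (-((1 : Matrix (Idx n) (Idx n) ℝ) ⊗ₖ (L * B))) 1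

/-- The block diagonal weight of the two-step problem. -/
def stageP (V : Matrix (Idx n) (Idx n) ℝ) (H₁ H₂ : Matrix (Idx m) (Idx m) ℝ) :
    Matrix ((Idx n × Idx m) ⊕ (Idx n × Idx m)) ((Idx n × Idx m) ⊕ (Idx n × Idx m)) ℝ :=
  Matrix.fromBlocks (V ⊗ₖ H₁) 0 0 (V ⊗ₖ H₂)

/-- The unconstrained target of the two-step problem. -/
def stageY (A : Matrix (Idx n) (Idx n) ℝ) (L₁ L₂ : Matrix (Idx m) (Idx n) ℝ) :
    (Idx n × Idx m) ⊕ (Idx n × Idx m) → ℝ :=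
  Sum.elim (Matrix.vec L₁) (Matrix.vec (L₂ * A))

theorem vecD_fromCols (F M : Matrix (Idx m) (Idx n) ℝ) :
    vecD (Matrix.fromCols F M) = Sum.elim (Matrix.vec F) (Matrix.vec M) := by
  ext (p | p) <;> simp [vecD]

theorem exists_eq_vecD (v : (Idx n × Idx m) ⊕ (Idx n × Idx m) → ℝ) :
    ∃ F M : Matrix (Idx m) (Idx n) ℝ, v = vecD (Matrix.fromCols F M) := by
  refine ⟨.of fun a b => v (.inl (b, a)), .of fun a b => v (.inr (b, a)), ?_⟩
  rw [vecD_fromCols]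
  ext (p | p) <;> rfl

theorem vec_vanishes_iff_blockDiag (F : Matrix (Idx m) (Idx n) ℝ) :
    (∀ i ∉ SF n m, Matrix.vec F i = 0) ↔ BlockDiag F := by
  constructor
  · intro h a b hab
    exact h (b, a) (by simpa [SF] using fun h => hab h.symm)
  · rintro h ⟨b, a⟩ hi
    exact h a b (by simpa [SF, eq_comm] using hi)

theorem vecD_vanishes_iff (F M : Matrix (Idx m) (Idx n) ℝ) :
    (∀ i ∉ SD n m, vecD (Matrix.fromCols F M) i = 0) ↔ BlockDiag F ∧ BlockTridiag M := by
  rw [vecD_fromCols, ← vec_vanishes_iff_blockDiag]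
  constructor
  · refine fun h => ⟨fun i hi => h (.inl i) (by simpa [SD] using hi), fun a b hab => ?_⟩
    exact h (.inr (b, a)) (by simpa [SD, SM] using hab)
  · rintro ⟨hF, hM⟩ (i | ⟨b, a⟩) hi
    · exact hF i (by simpa [SD] using hi)
    · exact hM a b (by simpa [SD, SM] using hi)

/-- The part of the cost that depends on the response of the inputs at times `j` and `j + 1` to the
disturbance entering the state at time `j`. -/
def stageCost (A : Matrix (Idx n) (Idx n) ℝ) (B : Matrix (Idx n) (Idx m) ℝ)
    (V : Matrix (Idx n) (Idx n) ℝ) (H₁ H₂ : Matrix (Idx m) (Idx m) ℝ)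
    (L₁ L₂ F M : Matrix (Idx m) (Idx n) ℝ) : ℝ :=
  wtr H₁ V (F - L₁) + wtr H₂ V (M - L₂ * (A + B * F))

/-- The residual stacks `F - L₁` and `M - L₂ B F - L₂ A`: the term linear in `F` sits in `stageT`,
the constant `L₂ A` in the target. -/
theorem lsq_stage (A : Matrix (Idx n) (Idx n) ℝ) (B : Matrix (Idx n) (Idx m) ℝ)
    {V : Matrix (Idx n) (Idx n) ℝ} (hV : Vᵀ = V) (H₁ H₂ : Matrix (Idx m) (Idx m) ℝ)
    (L₁ L₂ F M : Matrix (Idx m) (Idx n) ℝ) :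
    lsq (stageP V H₁ H₂) (stageT B L₂) (stageY A L₁ L₂) (vecD (Matrix.fromCols F M))
      = stageCost A B V H₁ H₂ L₁ L₂ F M := by
  have h : stageT B L₂ *ᵥ vecD (Matrix.fromCols F M) - stageY A L₁ L₂
      = Sum.elim (Matrix.vec (F - L₁)) (Matrix.vec (M - L₂ * (A + B * F))) := by
    rw [vecD_fromCols, stageT, stageY, Matrix.fromBlocks_mulVec]
    simp only [Sum.elim_comp_inl, Sum.elim_comp_inr, Matrix.one_mulVec, Matrix.zero_mulVec, add_zero,
      Matrix.neg_mulVec, Matrix.kronecker_mulVec_vec, Matrix.transpose_one, Matrix.mul_one,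
      Matrix.mul_add, Matrix.vec_sub, Matrix.vec_add, ← Matrix.mul_assoc]
    ext (p | p)
    · rfl
    · simp only [Pi.sub_apply, Sum.elim_inr, Pi.add_apply, Pi.neg_apply]
      ring
  rw [lsq, h, stageP, Matrix.fromBlocks_mulVec, sumElim_dotProduct_sumElim]
  simp only [Sum.elim_comp_inl, Sum.elim_comp_inr, Matrix.zero_mulVec, add_zero, zero_add,
    vec_dotProduct_kronecker_mulVec_vec _ hV]
  rfl

theorem lsq_single_stage {V : Matrix (Idx n) (Idx n) ℝ} (hV : Vᵀ = V)
    (H : Matrix (Idx m) (Idx m) ℝ) (L F : Matrix (Idx m) (Idx n) ℝ) :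
    lsq (V ⊗ₖ H) 1 (Matrix.vec L) (Matrix.vec F) = wtr H V (F - L) := by
  rw [lsq, Matrix.one_mulVec, ← Matrix.vec_sub, vec_dotProduct_kronecker_mulVec_vec _ hV]

theorem stageP_posSemidef {V : Matrix (Idx n) (Idx n) ℝ} {H₁ H₂ : Matrix (Idx m) (Idx m) ℝ}
    (hV : V.PosSemidef) (h₁ : H₁.PosSemidef) (h₂ : H₂.PosSemidef) :
    (stageP V H₁ H₂).PosSemidef :=
  posSemidef_fromBlocks_diag (hV.kronecker h₁) (hV.kronecker h₂)

theorem stage_posDef (B : Matrix (Idx n) (Idx m) ℝ) (L : Matrix (Idx m) (Idx n) ℝ)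
    {V : Matrix (Idx n) (Idx n) ℝ} {H₁ H₂ : Matrix (Idx m) (Idx m) ℝ}
    (hV : V.PosDef) (h₁ : H₁.PosDef) (h₂ : H₂.PosDef) :
    ((stageT B L)ᵀ * stageP V H₁ H₂ * stageT B L).PosDef := by
  have hP : (stageP V H₁ H₂).PosDef :=
    posDef_fromBlocks_diag (hV.kronecker h₁) (hV.kronecker h₂)
  -- `stageT` is block lower triangular with identity diagonal blocks, so its determinant is 1.
  have hT : Function.Injective (stageT B L).mulVec := by
    rw [Matrix.mulVec_injective_iff_isUnit, Matrix.isUnit_iff_isUnit_det, stageT,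
      Matrix.det_fromBlocks_zero₁₂]
    simp
  simpa using hP.conjTranspose_mul_mul_same hT

theorem transpose_stageT_mul_stageP (B : Matrix (Idx n) (Idx m) ℝ) (L : Matrix (Idx m) (Idx n) ℝ)
    (V : Matrix (Idx n) (Idx n) ℝ) (H₁ H₂ : Matrix (Idx m) (Idx m) ℝ) :
    (stageT B L)ᵀ * stageP V H₁ H₂
      = Matrix.fromBlocks (V ⊗ₖ H₁) (-(V ⊗ₖ (Bᵀ * Lᵀ * H₂))) 0 (V ⊗ₖ H₂) := by
  simp [stageT, stageP, Matrix.fromBlocks_transpose, Matrix.fromBlocks_multiply,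
    ← Matrix.kroneckerMap_transpose, ← Matrix.mul_kronecker_mul]

theorem stage_normal_matrix (B : Matrix (Idx n) (Idx m) ℝ) (L : Matrix (Idx m) (Idx n) ℝ)
    {V : Matrix (Idx n) (Idx n) ℝ} (hV : Vᵀ = V) (H₁ : Matrix (Idx m) (Idx m) ℝ)
    {H₂ : Matrix (Idx m) (Idx m) ℝ} (h₂ : H₂ᵀ = H₂) :
    (stageT B L)ᵀ * stageP V H₁ H₂ * stageT B L
      = Matrix.fromBlocks (V ⊗ₖ (H₁ + Bᵀ * Lᵀ * H₂ * L * B)) (-(V ⊗ₖ (Bᵀ * Lᵀ * H₂)))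
          (-(V ⊗ₖ (Bᵀ * Lᵀ * H₂)))ᵀ (V ⊗ₖ H₂) := by
  rw [transpose_stageT_mul_stageP, stageT, Matrix.fromBlocks_multiply]
  simp [← Matrix.kroneckerMap_transpose, ← Matrix.mul_kronecker_mul, hV, h₂, Matrix.kronecker_add,
    Matrix.mul_assoc]

theorem stage_normal_vector (A : Matrix (Idx n) (Idx n) ℝ) (B : Matrix (Idx n) (Idx m) ℝ)
    (L₁ L₂ : Matrix (Idx m) (Idx n) ℝ) (V : Matrix (Idx n) (Idx n) ℝ)
    (H₁ H₂ : Matrix (Idx m) (Idx m) ℝ) :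
    ((stageT B L₂)ᵀ * stageP V H₁ H₂) *ᵥ stageY A L₁ L₂
      = Sum.elim ((V ⊗ₖ H₁) *ᵥ Matrix.vec L₁) 0
        + Sum.elim ((-(V ⊗ₖ (Bᵀ * L₂ᵀ * H₂))) *ᵥ Matrix.vec (L₂ * A))
            ((V ⊗ₖ H₂) *ᵥ Matrix.vec (L₂ * A)) := by
  rw [transpose_stageT_mul_stageP, stageY, Matrix.fromBlocks_mulVec]
  ext (p | p) <;> simp

end Stage

/-! ### Completion of squares along the Riccati recursion. -/

section Riccati

variable {n m : Fin 3 → ℕ}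

/-- Completion of squares in one step of the Riccati recursion. -/
theorem riccati_step {A X Q : Matrix (Idx n) (Idx n) ℝ} {B : Matrix (Idx n) (Idx m) ℝ}
    {R H : Matrix (Idx m) (Idx m) ℝ} {L : Matrix (Idx m) (Idx n) ℝ} (hX : Xᵀ = X) (hHt : Hᵀ = H)
    (hH : H = Bᵀ * X * B + R) (hHu : IsUnit H.det) (hL : L = -(H⁻¹ * (Bᵀ * X * A)))
    {β : Type*} [Fintype β] (Φ : Matrix (Idx n) β ℝ) (Γ : Matrix (Idx m) β ℝ) :
    (A * Φ + B * Γ)ᵀ * X * (A * Φ + B * Γ) + Φᵀ * Q * Φ + Γᵀ * R * Γ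
      = Φᵀ * (Aᵀ * X * A + Q - (Aᵀ * X * B) * H⁻¹ * (Bᵀ * X * A)) * Φ
        + (Γ - L * Φ)ᵀ * H * (Γ - L * Φ) := by
  -- This choice of `L` makes the cross terms of the square match the mixed terms in `Φ` and `Γ`.
  have hHL : H * L = -(Bᵀ * X * A) := by
    rw [hL, Matrix.mul_neg, Matrix.mul_nonsing_inv_cancel_left _ _ hHu]
  have hLH : Lᵀ * H = -(Aᵀ * X * B) := by
    have := congrArg Matrix.transpose hHL
    rw [Matrix.transpose_mul, hHt] at this
    rw [this]
    simp [Matrix.transpose_mul, hX, Matrix.mul_assoc]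
  have e : (Γ - L * Φ)ᵀ * H * (Γ - L * Φ)
      = Γᵀ * H * Γ - Γᵀ * (H * L) * Φ - Φᵀ * (Lᵀ * H) * Γ + Φᵀ * ((Lᵀ * H) * L) * Φ := by
    simp only [Matrix.transpose_sub, Matrix.transpose_mul, Matrix.sub_mul, Matrix.mul_sub,
      Matrix.mul_assoc]
    abel
  rw [e, hHL, hLH, hL, hH]
  simp only [Matrix.transpose_add, Matrix.transpose_mul, Matrix.add_mul, Matrix.mul_add,
      Matrix.sub_mul, Matrix.mul_sub, Matrix.mul_assoc, Matrix.neg_mul, Matrix.mul_neg]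
  abel

variable (A : Matrix (Idx n) (Idx n) ℝ) (B : Matrix (Idx n) (Idx m) ℝ)
variable {Q0 Q : Matrix (Idx n) (Idx n) ℝ} {R : Matrix (Idx m) (Idx m) ℝ}

theorem posDef_gram_add (hR : R.PosDef) {X : Matrix (Idx n) (Idx n) ℝ} (hX : X.PosSemidef) :
    (Bᵀ * X * B + R).PosDef := by
  simpa using Matrix.PosDef.posSemidef_add (hX.conjTranspose_mul_mul_same B) hR

/-- Taking `Φ = 1` and `Γ = L` kills the completed square and exhibits the next Riccati matrix as
`(A + B L)ᵀ X (A + B L) + Q + Lᵀ R L`. -/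
theorem riccati_step_posSemidef (hQ : Q.PosSemidef) (hR : R.PosDef)
    {X : Matrix (Idx n) (Idx n) ℝ} (hX : X.PosSemidef) :
    (Aᵀ * X * A + Q - (Aᵀ * X * B) * (Bᵀ * X * B + R)⁻¹ * (Bᵀ * X * A)).PosSemidef := by
  have hH := posDef_gram_add B hR hX
  obtain ⟨L, hL⟩ : ∃ L, L = -((Bᵀ * X * B + R)⁻¹ * (Bᵀ * X * A)) := ⟨_, rfl⟩
  have h := riccati_step (A := A) (Q := Q) (transpose_eq_of_posSemidef hX)
    (transpose_eq_of_posSemidef hH.posSemidef) rfl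
    ((Matrix.isUnit_iff_isUnit_det _).1 hH.isUnit) hL 1 L
  rw [Matrix.mul_one, Matrix.mul_one, Matrix.mul_one, Matrix.mul_one, sub_self, Matrix.mul_zero,
    add_zero, Matrix.transpose_one, Matrix.one_mul, Matrix.one_mul] at h
  rw [← h]
  refine Matrix.PosSemidef.add (Matrix.PosSemidef.add ?_ hQ) ?_
  · rw [← Matrix.conjTranspose_eq_transpose_of_trivial]
    exact hX.conjTranspose_mul_mul_same _
  · rw [← Matrix.conjTranspose_eq_transpose_of_trivial]
    exact hR.posSemidef.conjTranspose_mul_mul_same _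

theorem riccatiRev_posSemidef (hQ0 : Q0.PosSemidef) (hQ : Q.PosSemidef) (hR : R.PosDef) (j : ℕ) :
    (riccatiRev A B Q0 Q R j).PosSemidef := by
  induction j with
  | zero => exact hQ0
  | succ j ih => exact riccati_step_posSemidef A B hQ hR ih

variable (N : ℕ)

theorem ricX_posSemidef (hQ0 : Q0.PosSemidef) (hQ : Q.PosSemidef) (hR : R.PosDef) (k : ℕ) :
    (ricX A B Q0 Q R N k).PosSemidef := riccatiRev_posSemidef A B hQ0 hQ hR _

theorem ricH_posDef (hQ0 : Q0.PosSemidef) (hQ : Q.PosSemidef) (hR : R.PosDef) (k : ℕ) :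
    (ricH A B Q0 Q R N k).PosDef := posDef_gram_add B hR (ricX_posSemidef A B N hQ0 hQ hR _)

theorem ricX_step (hQ0 : Q0.PosSemidef) (hQ : Q.PosSemidef) (hR : R.PosDef) {k : ℕ} (hk : k < N)
    {β : Type*} [Fintype β] (Φ : Matrix (Idx n) β ℝ) (Γ : Matrix (Idx m) β ℝ) :
    (A * Φ + B * Γ)ᵀ * ricX A B Q0 Q R N (k + 1) * (A * Φ + B * Γ) + Φᵀ * Q * Φ + Γᵀ * R * Γ
      = Φᵀ * ricX A B Q0 Q R N k * Φ
        + (Γ - ricL A B Q0 Q R N k * Φ)ᵀ * ricH A B Q0 Q R N k * (Γ - ricL A B Q0 Q R N k * Φ) := by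
  have hH := ricH_posDef A B N hQ0 hQ hR k
  rw [riccati_step (transpose_eq_of_posSemidef (ricX_posSemidef A B N hQ0 hQ hR (k + 1)))
    (transpose_eq_of_posSemidef hH.posSemidef) rfl ((Matrix.isUnit_iff_isUnit_det _).1 hH.isUnit)
    rfl Φ Γ]
  have hX : ricX A B Q0 Q R N k = Aᵀ * ricX A B Q0 Q R N (k + 1) * A + Q
      - (Aᵀ * ricX A B Q0 Q R N (k + 1) * B) * (ricH A B Q0 Q R N k)⁻¹
        * (Bᵀ * ricX A B Q0 Q R N (k + 1) * A) := by
    -- Here `k < N` matters: the subtraction is truncated.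
    rw [ricH, ricX, show N - k = (N - (k + 1)) + 1 by omega, riccatiRev]
    rfl
  rw [hX]
  rfl

end Riccati

/-! ### Responses of the closed loop, and their realization by admissible laws. -/

section Response

variable {n m : Fin 3 → ℕ}
variable {A : Matrix (Idx n) (Idx n) ℝ} {B : Matrix (Idx n) (Idx m) ℝ}

/-- The disturbance sequence `x(0), w(0), w(1), …`. -/
def drive (x0 : Idx n → ℝ) (w : ℕ → Idx n → ℝ) : ℕ → Idx n → ℝ
  | 0 => x0
  | k + 1 => w k

/-- `Φ k j` is the response of the state at time `k` to the `j`-th disturbance when the response of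
the input is `Γ`. -/
structure IsResponse (A : Matrix (Idx n) (Idx n) ℝ) (B : Matrix (Idx n) (Idx m) ℝ)
    (Γ : ℕ → ℕ → Matrix (Idx m) (Idx n) ℝ) (Φ : ℕ → ℕ → Matrix (Idx n) (Idx n) ℝ) : Prop where
  init : ∀ j, Φ 0 j = if j = 0 then 1 else 0
  step : ∀ k j, Φ (k + 1) j = A * Φ k j + B * Γ k j + if j = k + 1 then 1 else 0
  causal : ∀ k j, k < j → Γ k j = 0

namespace IsResponse

variable {Γ : ℕ → ℕ → Matrix (Idx m) (Idx n) ℝ} {Φ : ℕ → ℕ → Matrix (Idx n) (Idx n) ℝ}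

theorem state_eq_zero (h : IsResponse A B Γ Φ) {k j : ℕ} (hkj : k < j) : Φ k j = 0 := by
  induction k with
  | zero => rw [h.init, if_neg (by omega)]
  | succ k ih =>
    rw [h.step, ih (by omega), h.causal k j (by omega), if_neg (by omega)]
    simp

theorem state_self (h : IsResponse A B Γ Φ) (k : ℕ) : Φ k k = 1 := by
  cases k with
  | zero => simp [h.init]
  | succ k => simp [h.step, h.state_eq_zero (Nat.lt_succ_self k), h.causal k (k + 1) (by omega)]

theorem state_succ_self (h : IsResponse A B Γ Φ) (k : ℕ) : Φ (k + 1) k = A + B * Γ k k := by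
  simp [h.step, h.state_self]

end IsResponse

theorem state_succ (K : Law n m) (x0 : Idx n → ℝ) (w : ℕ → Idx n → ℝ) (k : ℕ) :
    state A B K x0 w (k + 1) = A *ᵥ state A B K x0 w k + B *ᵥ input A B K x0 w k + w k := by
  rw [state]
  rfl

theorem input_eq_sum_range (K : Law n m) (x0 : Idx n → ℝ) (w : ℕ → Idx n → ℝ) (k : ℕ) :
    input A B K x0 w k = ∑ j ∈ Finset.range (k + 1), K k j *ᵥ state A B K x0 w j :=
  Fin.sum_univ_eq_sum_range (fun j => K k j *ᵥ state A B K x0 w j) (k + 1)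

variable {Γ : ℕ → ℕ → Matrix (Idx m) (Idx n) ℝ} {Φ : ℕ → ℕ → Matrix (Idx n) (Idx n) ℝ}

theorem sum_mulVec_extend {α β : Type*} [Fintype β] {C : ℕ → Matrix α β ℝ} {k p : ℕ} (hp : k < p)
    (hC : ∀ j, k < j → C j = 0) (v : ℕ → β → ℝ) :
    ∑ j ∈ Finset.range (k + 1), C j *ᵥ v j = ∑ j ∈ Finset.range p, C j *ᵥ v j := by
  refine Finset.sum_subset (Finset.range_subset_range.2 (by omega)) fun j _ hj => ?_
  rw [hC j (by simpa using hj), Matrix.zero_mulVec]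

theorem IsResponse.state_succ_eq (h : IsResponse A B Γ Φ) (K : Law n m) (x0 : Idx n → ℝ)
    (w : ℕ → Idx n → ℝ) {k : ℕ}
    (hx : state A B K x0 w k = ∑ j ∈ Finset.range (k + 1), Φ k j *ᵥ drive x0 w j)
    (hu : input A B K x0 w k = ∑ j ∈ Finset.range (k + 1), Γ k j *ᵥ drive x0 w j) :
    state A B K x0 w (k + 1) = ∑ j ∈ Finset.range (k + 2), Φ (k + 1) j *ᵥ drive x0 w j := by
  rw [state_succ, hx, hu, Finset.sum_range_succ _ (k + 1), h.state_self, Matrix.one_mulVec,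
    Matrix.mulVec_sum, Matrix.mulVec_sum, ← Finset.sum_add_distrib]
  congr 1
  refine Finset.sum_congr rfl fun j hj => ?_
  have : j ≠ k + 1 := by have := Finset.mem_range.1 hj; omega
  rw [h.step, if_neg this, add_zero, Matrix.add_mulVec, Matrix.mulVec_mulVec, Matrix.mulVec_mulVec]

theorem IsResponse.state_eq (h : IsResponse A B Γ Φ) (K : Law n m) (x0 : Idx n → ℝ)
    (w : ℕ → Idx n → ℝ)
    (hu : ∀ k, input A B K x0 w k = ∑ j ∈ Finset.range (k + 1), Γ k j *ᵥ drive x0 w j) (k : ℕ) :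
    state A B K x0 w k = ∑ j ∈ Finset.range (k + 1), Φ k j *ᵥ drive x0 w j := by
  induction k with
  | zero => simp [state, h.init, drive]
  | succ k ih => exact h.state_succ_eq K x0 w ih (hu k)

/-- The response of the state to the `j`-th disturbance under the law `K`. -/
noncomputable def stateResponse (A : Matrix (Idx n) (Idx n) ℝ) (B : Matrix (Idx n) (Idx m) ℝ)
    (K : Law n m) (j : ℕ) : ℕ → Matrix (Idx n) (Idx n) ℝ
  | 0 => if j = 0 then 1 else 0
  | k + 1 => A * stateResponse A B K j k
      + B * (∑ i : Fin (k + 1), K k i * stateResponse A B K j i) + if j = k + 1 then 1 else 0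
termination_by k => k
decreasing_by
  · exact Nat.lt_succ_self k
  · exact i.2

/-- The response of the input to the `j`-th disturbance under the law `K`. -/
noncomputable def inputResponse (A : Matrix (Idx n) (Idx n) ℝ) (B : Matrix (Idx n) (Idx m) ℝ)
    (K : Law n m) (k j : ℕ) : Matrix (Idx m) (Idx n) ℝ :=
  ∑ i ∈ Finset.range (k + 1), K k i * stateResponse A B K j i

theorem stateResponse_succ (K : Law n m) (k j : ℕ) :
    stateResponse A B K j (k + 1) = A * stateResponse A B K j k + B * inputResponse A B K k j
      + if j = k + 1 then 1 else 0 := by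
  rw [stateResponse, inputResponse,
    Fin.sum_univ_eq_sum_range (fun i => K k i * stateResponse A B K j i) (k + 1)]

theorem stateResponse_eq_zero (K : Law n m) {k j : ℕ} (hkj : k < j) :
    stateResponse A B K j k = 0 := by
  induction k using Nat.strong_induction_on with
  | _ k ih =>
    cases k with
    | zero => rw [stateResponse, if_neg (by omega)]
    | succ k =>
      rw [stateResponse_succ, ih k (by omega) (by omega), if_neg (by omega), inputResponse,
        Finset.sum_eq_zero]
      · simp
      · intro i hi
        have := Finset.mem_range.1 hi
        rw [ih i (by omega) (by omega), Matrix.mul_zero]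

theorem isResponse_of_law (A : Matrix (Idx n) (Idx n) ℝ) (B : Matrix (Idx n) (Idx m) ℝ)
    (K : Law n m) : IsResponse A B (inputResponse A B K) fun k j => stateResponse A B K j k where
  init j := by rw [stateResponse]
  step k j := stateResponse_succ K k j
  causal k j hkj := Finset.sum_eq_zero fun i hi => by
    have := Finset.mem_range.1 hi
    rw [stateResponse_eq_zero K (by omega), Matrix.mul_zero]

theorem input_eq_of_state_eq (K : Law n m) (x0 : Idx n → ℝ) (w : ℕ → Idx n → ℝ) (k : ℕ)
    (hx : ∀ i ≤ k, state A B K x0 w i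
      = ∑ j ∈ Finset.range (i + 1), stateResponse A B K j i *ᵥ drive x0 w j) :
    input A B K x0 w k = ∑ j ∈ Finset.range (k + 1), inputResponse A B K k j *ᵥ drive x0 w j := by
  have h : ∀ i ∈ Finset.range (k + 1), K k i *ᵥ state A B K x0 w i
      = ∑ j ∈ Finset.range (k + 1), (K k i * stateResponse A B K j i) *ᵥ drive x0 w j := by
    intro i hi
    have hi' := Finset.mem_range.1 hi
    rw [hx i (by omega), sum_mulVec_extend (C := fun j => stateResponse A B K j i) hi'
      (fun j hj => stateResponse_eq_zero K hj), Matrix.mulVec_sum]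
    simp only [Matrix.mulVec_mulVec]
  rw [input_eq_sum_range, Finset.sum_congr rfl h, Finset.sum_comm]
  simp only [inputResponse, Matrix.sum_mulVec]

/-- The induction is strong because the input at time `k` feeds back all states up to time `k`. -/
theorem state_eq_response (K : Law n m) (x0 : Idx n → ℝ) (w : ℕ → Idx n → ℝ) (k : ℕ) :
    state A B K x0 w k
      = ∑ j ∈ Finset.range (k + 1), stateResponse A B K j k *ᵥ drive x0 w j := by
  induction k using Nat.strong_induction_on with
  | _ k ih =>
    cases k with
    | zero => simp [state, stateResponse, drive]
    | succ k =>
      exact (isResponse_of_law A B K).state_succ_eq K x0 w (ih k (by omega))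
        (input_eq_of_state_eq K x0 w k fun i hi => ih i (by omega))

theorem input_eq_response (K : Law n m) (x0 : Idx n → ℝ) (w : ℕ → Idx n → ℝ) (k : ℕ) :
    input A B K x0 w k
      = ∑ j ∈ Finset.range (k + 1), inputResponse A B K k j *ᵥ drive x0 w j :=
  input_eq_of_state_eq K x0 w k fun i _ => state_eq_response K x0 w i

theorem inputResponse_self (K : Law n m) (k : ℕ) : inputResponse A B K k k = gainF K k := by
  have h := isResponse_of_law A B K
  rw [inputResponse, Finset.sum_range_succ, Finset.sum_eq_zero, h.state_self k, Matrix.mul_one,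
    zero_add, gainF]
  intro i hi
  rw [stateResponse_eq_zero K (Finset.mem_range.1 hi), Matrix.mul_zero]

/-- This explains the definition of `M`: the `k`-th disturbance reaches `u(k+1)` through `x(k)`,
with response 1 and gain `G(k+1)`, and through `x(k+1)`, with response `A + B F(k)` and gain
`F(k+1)`. -/
theorem inputResponse_succ_self (K : Law n m) (k : ℕ) :
    inputResponse A B K (k + 1) k = gainM A B K (k + 1) := by
  have h := isResponse_of_law A B K
  rw [inputResponse, Finset.sum_range_succ, Finset.sum_range_succ, Finset.sum_eq_zero,
    h.state_self k, h.state_succ_self k, inputResponse_self, Matrix.mul_one, zero_add, add_comm]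
  · rfl
  · intro i hi
    rw [stateResponse_eq_zero K (Finset.mem_range.1 hi), Matrix.mul_zero]

/-! ### Patterns -/

theorem BlockDiag.mul {r s t : Fin 3 → ℕ} {S : Matrix (Idx r) (Idx s) ℝ}
    {T : Matrix (Idx s) (Idx t) ℝ} (hS : BlockDiag S) (hT : BlockDiag T) : BlockDiag (S * T) := by
  intro a b hab
  rw [Matrix.mul_apply]
  refine Finset.sum_eq_zero fun c _ => ?_
  by_cases h : a.1 = c.1
  · rw [hT c b (h ▸ hab), mul_zero]
  · rw [hS a c h, zero_mul]

theorem BlockDiag.mul_blockTridiag {r s t : Fin 3 → ℕ} {S : Matrix (Idx r) (Idx s) ℝ}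
    {T : Matrix (Idx s) (Idx t) ℝ} (hS : BlockDiag S) (hT : BlockTridiag T) :
    BlockTridiag (S * T) := by
  intro a b hab
  rw [Matrix.mul_apply]
  refine Finset.sum_eq_zero fun c _ => ?_
  by_cases h : a.1 = c.1
  · rw [hT c b (h ▸ hab), mul_zero]
  · rw [hS a c h, zero_mul]

theorem BlockDiag.blockTridiag {r s : Fin 3 → ℕ} {S : Matrix (Idx r) (Idx s) ℝ}
    (hS : BlockDiag S) : BlockTridiag S := by
  intro a b hab
  refine hS a b fun h => hab ?_
  rw [h, Near]
  omega

theorem BlockTridiag.add {r s : Fin 3 → ℕ} {S T : Matrix (Idx r) (Idx s) ℝ}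
    (hS : BlockTridiag S) (hT : BlockTridiag T) : BlockTridiag (S + T) := fun a b hab => by
  rw [Matrix.add_apply, hS a b hab, hT a b hab, add_zero]

theorem BlockTridiag.sub {r s : Fin 3 → ℕ} {S T : Matrix (Idx r) (Idx s) ℝ}
    (hS : BlockTridiag S) (hT : BlockTridiag T) : BlockTridiag (S - T) := fun a b hab => by
  rw [Matrix.sub_apply, hS a b hab, hT a b hab, sub_zero]

theorem Admissible.blockDiag_gainF {K : Law n m} (hK : Admissible K) (k : ℕ) :
    BlockDiag (gainF K k) := by
  intro a b hab
  refine hK k k a b ?_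
  rintro (⟨_, h⟩ | ⟨h, _⟩ | h)
  · exact hab h.symm
  · omega
  · omega

theorem Admissible.blockTridiag_gainM {K : Law n m} (hK : Admissible K) (hA : BlockTridiag A)
    (hB : BlockDiag B) (k : ℕ) : BlockTridiag (gainM A B K (k + 1)) := by
  refine ((hK.blockDiag_gainF (k + 1)).mul_blockTridiag
    (hA.add (hB.mul (hK.blockDiag_gainF k)).blockTridiag)).add fun a b hab => hK (k + 1) k a b ?_
  rintro (⟨h, _⟩ | ⟨_, h⟩ | h)
  · omega
  · exact hab h
  · omega

/-! ### Realization of a prescribed response -/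

/-- The law whose input response is `Γ`. -/
noncomputable def realize (A : Matrix (Idx n) (Idx n) ℝ) (B : Matrix (Idx n) (Idx m) ℝ)
    (Γ : ℕ → ℕ → Matrix (Idx m) (Idx n) ℝ) (k i : ℕ) : Matrix (Idx m) (Idx n) ℝ :=
  Γ k i - ∑ j : Fin k, Γ k (j + 1) * ((if i = j then A else 0) + B * realize A B Γ j i)
termination_by k
decreasing_by exact j.2

/-- The formula results from substituting `w(j) = x(j+1) - A x(j) - B u(j)` into `u(k) = Γ(k,0) x(0)
+ ∑ Γ(k,j+1) w(j)` and collecting the coefficient of `x(i)`. -/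
theorem realize_eq (k i : ℕ) : realize A B Γ k i = Γ k i
    - ∑ j ∈ Finset.range k, Γ k (j + 1) * ((if i = j then A else 0) + B * realize A B Γ j i) := by
  rw [realize, Fin.sum_univ_eq_sum_range
    (fun j => Γ k (j + 1) * ((if i = j then A else 0) + B * realize A B Γ j i)) k]

theorem realize_eq_zero (hΓ : ∀ k j, k < j → Γ k j = 0) {k i : ℕ} (hki : k < i) :
    realize A B Γ k i = 0 := by
  induction k using Nat.strong_induction_on with
  | _ k ih =>
    rw [realize_eq, hΓ k i hki, Finset.sum_eq_zero, sub_zero]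
    intro j hj
    have := Finset.mem_range.1 hj
    rw [ih j this (by omega), if_neg (by omega)]
    simp

theorem realize_self (hΓ : ∀ k j, k < j → Γ k j = 0) (k : ℕ) : realize A B Γ k k = Γ k k := by
  rw [realize_eq, Finset.sum_eq_zero, sub_zero]
  intro j hj
  have := Finset.mem_range.1 hj
  rw [realize_eq_zero hΓ this, if_neg (by omega)]
  simp

theorem realize_succ_self (hΓ : ∀ k j, k < j → Γ k j = 0) (k : ℕ) :
    realize A B Γ (k + 1) k = Γ (k + 1) k - Γ (k + 1) (k + 1) * (A + B * Γ k k) := by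
  rw [realize_eq, Finset.sum_range_succ, Finset.sum_eq_zero, zero_add, if_pos rfl, realize_self hΓ]
  intro j hj
  have := Finset.mem_range.1 hj
  rw [realize_eq_zero hΓ this, if_neg (by omega)]
  simp

/-- Only the gains on `x(k)` and `x(k-1)` are constrained, and they depend only on the two leading
diagonals of `Γ`. -/
theorem admissible_realize (hΓ : ∀ k j, k < j → Γ k j = 0) (hA : BlockTridiag A)
    (hB : BlockDiag B) (hF : ∀ k, BlockDiag (Γ k k)) (hM : ∀ k, BlockTridiag (Γ (k + 1) k)) :
    Admissible (realize A B Γ) := by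
  intro k j a b hab
  rcases lt_trichotomy k j with h | rfl | h
  · rw [realize_eq_zero hΓ h, Matrix.zero_apply]
  · rw [realize_self hΓ]
    exact hF k a b fun h => hab (.inl ⟨rfl, h.symm⟩)
  · obtain rfl : k = j + 1 := by
      by_contra hne
      exact hab (.inr (.inr (by omega)))
    rw [realize_succ_self hΓ]
    exact ((hM j).sub ((hF (j + 1)).mul_blockTridiag (hA.add (hB.mul (hF j)).blockTridiag))) a b
      fun h => hab (.inr (.inl ⟨rfl, h⟩))

theorem input_realize (hΓ : ∀ k j, k < j → Γ k j = 0) (x0 : Idx n → ℝ) (w : ℕ → Idx n → ℝ)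
    (k : ℕ) : input A B (realize A B Γ) x0 w k
      = ∑ j ∈ Finset.range (k + 1), Γ k j *ᵥ drive x0 w j := by
  set x := state A B (realize A B Γ) x0 w with hx
  -- The correction terms rebuild `A x(j) + B u(j) = x(j+1) - w(j)`; subtracting them from `Γ(k,j+1)
  -- x(j+1)` leaves `Γ(k,j+1) w(j)`.
  have h : ∀ j ∈ Finset.range k,
      ∑ i ∈ Finset.range (k + 1),
        (Γ k (j + 1) * ((if i = j then A else 0) + B * realize A B Γ j i)) *ᵥ x i
      = Γ k (j + 1) *ᵥ (x (j + 1) - w j) := by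
    intro j hj
    have hj' := Finset.mem_range.1 hj
    have hu := input_eq_sum_range (A := A) (B := B) (realize A B Γ) x0 w j
    rw [sum_mulVec_extend (p := k + 1) (by omega) (fun i hi => realize_eq_zero hΓ hi)] at hu
    rw [hx, state_succ, add_sub_cancel_right, hu, ← hx, Matrix.mulVec_sum, Matrix.mulVec_add,
      Matrix.mulVec_sum]
    simp only [Matrix.mul_add, Matrix.add_mulVec, Finset.sum_add_distrib, Matrix.mulVec_mulVec]
    congr 1
    rw [Finset.sum_eq_single j]
    · simp
    · intro i _ hij
      simp [hij]
    · intro hjk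
      exact absurd (Finset.mem_range.2 (by omega)) hjk
  rw [input_eq_sum_range, ← hx]
  simp only [realize_eq (A := A) (B := B) (Γ := Γ) k, Matrix.sub_mulVec, Finset.sum_sub_distrib,
    Matrix.sum_mulVec]
  rw [Finset.sum_comm, Finset.sum_congr rfl h, Finset.sum_range_succ', Finset.sum_range_succ' _ k]
  simp only [Matrix.mulVec_sub, Finset.sum_sub_distrib, drive]
  rw [hx, state]
  abel

end Response

/-! ### Second moments of quadratic forms in the disturbances. -/

section Moments

variable {Ω : Type*} [MeasurableSpace Ω] {μ : Measure Ω} {n : Fin 3 → ℕ}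
variable {P0 W : Matrix (Idx n) (Idx n) ℝ} {x0 : Ω → Idx n → ℝ} {w : ℕ → Ω → Idx n → ℝ}

theorem IsNoise.memLp_drive (h : IsNoise μ P0 W x0 w) (j : ℕ) (a : Idx n) :
    MemLp (fun ω => drive (x0 ω) (fun k => w k ω) j a) 2 μ := by
  cases j with
  | zero => exact h.memLp_init a
  | succ j => exact h.memLp_noise j a

theorem IsNoise.mean_drive (h : IsNoise μ P0 W x0 w) (j : ℕ) (a : Idx n) :
    ∫ ω, drive (x0 ω) (fun k => w k ω) j a ∂μ = 0 := by
  cases j with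
  | zero => exact h.mean_init a
  | succ j => exact h.mean_noise j a

theorem IsNoise.cov_drive (h : IsNoise μ P0 W x0 w) (i j : ℕ) (a b : Idx n) :
    cov[fun ω => drive (x0 ω) (fun k => w k ω) i a, fun ω => drive (x0 ω) (fun k => w k ω) j b; μ]
      = if i = j then noiseCov P0 W (i + 1) a b else 0 := by
  rcases i with _ | i <;> rcases j with _ | j
  · simpa [drive, noiseCov] using h.cov_init a b
  · simpa [drive] using h.cov_init_noise j a b
  · rw [covariance_comm]
    simpa [drive] using h.cov_init_noise i b a
  · by_cases hij : i = j
    · subst hij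
      simpa [drive, noiseCov] using h.cov_noise i a b
    · simpa [drive, hij] using h.cov_noise_noise i j hij a b

theorem IsNoise.integral_drive_mul (h : IsNoise μ P0 W x0 w) (i j : ℕ) (a b : Idx n) :
    ∫ ω, drive (x0 ω) (fun k => w k ω) i a * drive (x0 ω) (fun k => w k ω) j b ∂μ
      = if i = j then noiseCov P0 W (i + 1) a b else 0 := by
  rw [← h.cov_drive i j a b, covariance, h.mean_drive, h.mean_drive]
  simp

theorem IsNoise.integrable_drive_mul (h : IsNoise μ P0 W x0 w) (i j : ℕ) (a b : Idx n) :
    Integrable (fun ω => drive (x0 ω) (fun k => w k ω) i a * drive (x0 ω) (fun k => w k ω) j b) μ :=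
  (h.memLp_drive i a).integrable_mul (h.memLp_drive j b)

theorem IsNoise.noiseCov_symm (h : IsNoise μ P0 W x0 w) (j : ℕ) :
    (noiseCov P0 W (j + 1))ᵀ = noiseCov P0 W (j + 1) := by
  ext a b
  have h1 := h.cov_drive j j a b
  have h2 := h.cov_drive j j b a
  rw [if_pos rfl] at h1 h2
  rw [Matrix.transpose_apply, ← h1, ← h2, covariance_comm]

theorem dotProduct_sum_mulVec {α β : Type*} [Fintype α] [Fintype β] (S : Matrix α α ℝ)
    (C : ℕ → Matrix α β ℝ) (v : ℕ → β → ℝ) (p : ℕ) :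
    (∑ j ∈ Finset.range p, C j *ᵥ v j) ⬝ᵥ (S *ᵥ ∑ j ∈ Finset.range p, C j *ᵥ v j)
      = ∑ i ∈ Finset.range p, ∑ j ∈ Finset.range p, ∑ a, ∑ b,
          ((C i)ᵀ * S * C j) a b * (v i a * v j b) := by
  rw [Matrix.mulVec_sum, sum_dotProduct]
  refine Finset.sum_congr rfl fun i _ => ?_
  rw [dotProduct_sum]
  refine Finset.sum_congr rfl fun j _ => ?_
  rw [dotProduct_comm, Matrix.dotProduct_mulVec, ← Matrix.mulVec_transpose, Matrix.mulVec_mulVec,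
    Matrix.mulVec_mulVec, dotProduct_comm, Matrix.mul_assoc]
  simp only [dotProduct, Matrix.mulVec, Finset.mul_sum]
  refine Finset.sum_congr rfl fun a _ => Finset.sum_congr rfl fun b _ => by ring

variable {α : Type*} [Fintype α]

theorem IsNoise.integrable_quadratic (h : IsNoise μ P0 W x0 w) (S : Matrix α α ℝ)
    (C : ℕ → Matrix α (Idx n) ℝ) (p : ℕ) :
    Integrable (fun ω => (∑ j ∈ Finset.range p, C j *ᵥ drive (x0 ω) (fun k => w k ω) j) ⬝ᵥ
      (S *ᵥ ∑ j ∈ Finset.range p, C j *ᵥ drive (x0 ω) (fun k => w k ω) j)) μ := by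
  simp only [dotProduct_sum_mulVec]
  exact integrable_finsetSum _ fun i _ => integrable_finsetSum _ fun j _ =>
    integrable_finsetSum _ fun a _ => integrable_finsetSum _ fun b _ =>
      (h.integrable_drive_mul i j a b).const_mul _

omit [Fintype α] in
-- Distinct disturbances are uncorrelated with zero mean, so only the diagonal `i = j` survives.
theorem IsNoise.integral_sum_drive_mul (h : IsNoise μ P0 W x0 w)
    (g : ℕ → ℕ → Idx n → Idx n → ℝ) (p : ℕ) :
    ∫ ω, (∑ i ∈ Finset.range p, ∑ j ∈ Finset.range p, ∑ a, ∑ b, g i j a b *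
      (drive (x0 ω) (fun k => w k ω) i a * drive (x0 ω) (fun k => w k ω) j b)) ∂μ
      = ∑ i ∈ Finset.range p, ∑ a, ∑ b, g i i a b * noiseCov P0 W (i + 1) a b := by
  have hI := fun i j a b => (h.integrable_drive_mul i j a b).const_mul (g i j a b)
  have key : ∀ i j, ∫ ω, (∑ a, ∑ b, g i j a b *
      (drive (x0 ω) (fun k => w k ω) i a * drive (x0 ω) (fun k => w k ω) j b)) ∂μ
      = if i = j then ∑ a, ∑ b, g i i a b * noiseCov P0 W (i + 1) a b else 0 := by
    intro i j
    rw [integral_finsetSum _ fun a _ => integrable_finsetSum _ fun b _ => hI i j a b]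
    simp only [integral_finsetSum Finset.univ fun b _ => hI i j _ b, integral_const_mul,
      h.integral_drive_mul]
    split_ifs with hij
    · subst hij
      rfl
    · simp
  rw [integral_finsetSum _ fun i _ => integrable_finsetSum _ fun j _ =>
    integrable_finsetSum _ fun a _ => integrable_finsetSum _ fun b _ => hI i j a b]
  refine Finset.sum_congr rfl fun i hi => ?_
  rw [integral_finsetSum _ fun j _ => integrable_finsetSum _ fun a _ =>
    integrable_finsetSum _ fun b _ => hI i j a b]
  simp only [key]
  rw [Finset.sum_ite_eq, if_pos hi]

theorem IsNoise.integral_quadratic (h : IsNoise μ P0 W x0 w) (S : Matrix α α ℝ)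
    (C : ℕ → Matrix α (Idx n) ℝ) (p : ℕ) :
    ∫ ω, (∑ j ∈ Finset.range p, C j *ᵥ drive (x0 ω) (fun k => w k ω) j) ⬝ᵥ
      (S *ᵥ ∑ j ∈ Finset.range p, C j *ᵥ drive (x0 ω) (fun k => w k ω) j) ∂μ
      = ∑ j ∈ Finset.range p, wtr S (noiseCov P0 W (j + 1)) (C j) := by
  simp only [dotProduct_sum_mulVec]
  refine (h.integral_sum_drive_mul (fun i j a b => ((C i)ᵀ * S * C j) a b) p).trans ?_
  refine Finset.sum_congr rfl fun i _ => ?_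
  have hs : ∀ a b, noiseCov P0 W (i + 1) a b = noiseCov P0 W (i + 1) b a := fun a b =>
    (congrFun (congrFun (h.noiseCov_symm i) a) b).symm
  simp only [wtr, Matrix.trace, Matrix.diag, Matrix.mul_apply (N := noiseCov P0 W (i + 1))]
  exact Finset.sum_congr rfl fun a _ => Finset.sum_congr rfl fun b _ => by rw [hs]

theorem IsNoise.noiseCov_posSemidef (h : IsNoise μ P0 W x0 w) (hW : W.PosSemidef) (j : ℕ) :
    (noiseCov P0 W (j + 1)).PosSemidef := by
  cases j with
  | succ j => simpa [noiseCov] using hW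
  | zero =>
    refine Matrix.PosSemidef.of_dotProduct_mulVec_nonneg ?_ fun z => ?_
    · rw [Matrix.IsHermitian, Matrix.conjTranspose_eq_transpose_of_trivial, h.noiseCov_symm]
    -- With the single row `zᵀ` as coefficient, `zᵀ P0 z` is the mean of the square of `zᵀ x(0)`.
    · have hq := h.integral_quadratic (1 : Matrix Unit Unit ℝ) (fun _ => Matrix.replicateRow Unit z) 1
      rw [Finset.sum_range_one, wtr] at hq
      have hz : star z ⬝ᵥ noiseCov P0 W (0 + 1) *ᵥ z
          = ((Matrix.replicateRow Unit z)ᵀ * (1 : Matrix Unit Unit ℝ) * Matrix.replicateRow Unit z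
              * noiseCov P0 W (0 + 1)).trace := by
        rw [Matrix.mul_one, Matrix.mul_assoc, Matrix.trace_mul_comm]
        simp only [Matrix.trace, Matrix.diag, Matrix.mul_apply, dotProduct, Matrix.mulVec,
          Finset.mul_sum, Finset.sum_mul, star_trivial, Matrix.transpose_apply,
          Matrix.replicateRow_apply, Finset.univ_unique, Finset.sum_singleton]
        rw [Finset.sum_comm]
        exact Finset.sum_congr rfl fun a _ => Finset.sum_congr rfl fun b _ => by ring
      rw [hz, ← hq]
      refine integral_nonneg fun ω => ?_
      simp only [Matrix.one_mulVec]
      exact Finset.sum_nonneg fun i _ => mul_self_nonneg _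

end Moments

/-! ### Decomposition of the cost and optimality of each stage. -/

section Cost

variable {Ω : Type*} [MeasurableSpace Ω] {μ : Measure Ω} {n m : Fin 3 → ℕ}
variable {P0 W : Matrix (Idx n) (Idx n) ℝ} {x0 : Ω → Idx n → ℝ} {w : ℕ → Ω → Idx n → ℝ}
variable {A : Matrix (Idx n) (Idx n) ℝ} {B : Matrix (Idx n) (Idx m) ℝ}
variable {Q0 Q : Matrix (Idx n) (Idx n) ℝ} {R : Matrix (Idx m) (Idx m) ℝ} {N : ℕ}
variable {Γ : ℕ → ℕ → Matrix (Idx m) (Idx n) ℝ} {Φ : ℕ → ℕ → Matrix (Idx n) (Idx n) ℝ}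

theorem cost_eq_sum_wtr (h : IsNoise μ P0 W x0 w) (hr : IsResponse A B Γ Φ) (K : Law n m)
    (hu : ∀ x0 w k, input A B K x0 w k = ∑ j ∈ Finset.range (k + 1), Γ k j *ᵥ drive x0 w j) :
    cost A B Q0 Q R N μ x0 w K
      = ∑ j ∈ Finset.range (N + 1), (wtr Q0 (noiseCov P0 W (j + 1)) (Φ N j)
        + ∑ k ∈ Finset.range N, (wtr Q (noiseCov P0 W (j + 1)) (Φ k j)
          + wtr R (noiseCov P0 W (j + 1)) (Γ k j))) := by
  have hx : ∀ k < N + 1, ∀ ω, state A B K (x0 ω) (fun j => w j ω) k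
      = ∑ j ∈ Finset.range (N + 1), Φ k j *ᵥ drive (x0 ω) (fun j => w j ω) j := fun k hk ω => by
    rw [hr.state_eq K _ _ (hu _ _), sum_mulVec_extend hk fun j hj => hr.state_eq_zero hj]
  have hu' : ∀ k < N + 1, ∀ ω, input A B K (x0 ω) (fun j => w j ω) k
      = ∑ j ∈ Finset.range (N + 1), Γ k j *ᵥ drive (x0 ω) (fun j => w j ω) j := fun k hk ω => by
    rw [hu, sum_mulVec_extend hk fun j hj => hr.causal k j hj]
  unfold cost
  simp only [hx N (Nat.lt_succ_self N)]
  rw [h.integral_quadratic, Finset.sum_add_distrib, Finset.sum_comm]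
  congr 1
  refine Finset.sum_congr rfl fun k hk => ?_
  have hk' : k < N + 1 := by have := Finset.mem_range.1 hk; omega
  simp only [hx k hk', hu' k hk']
  rw [integral_add (h.integrable_quadratic _ _ _) (h.integrable_quadratic _ _ _),
    h.integral_quadratic, h.integral_quadratic, Finset.sum_add_distrib]

theorem wtr_zero (S V : Matrix (Idx n) (Idx n) ℝ) : wtr S V (0 : Matrix (Idx n) (Idx n) ℝ) = 0 := by
  simp [wtr]

theorem wtr_zero' (S : Matrix (Idx m) (Idx m) ℝ) (V : Matrix (Idx n) (Idx n) ℝ) :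
    wtr S V (0 : Matrix (Idx m) (Idx n) ℝ) = 0 := by
  simp [wtr]

/-- For `j = k + 1` the disturbance has just entered: the response jumps from 0 to 1, independently
of the law. Otherwise this is `ricX_step` under the trace. -/
theorem wtr_step (hQ0 : Q0.PosSemidef) (hQ : Q.PosSemidef) (hR : R.PosDef)
    (hr : IsResponse A B Γ Φ) (V : Matrix (Idx n) (Idx n) ℝ) (j : ℕ) {k : ℕ} (hk : k < N) :
    wtr (ricX A B Q0 Q R N (k + 1)) V (Φ (k + 1) j) + (wtr Q V (Φ k j) + wtr R V (Γ k j))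
      = wtr (ricX A B Q0 Q R N k) V (Φ k j)
        + wtr (ricH A B Q0 Q R N k) V (Γ k j - ricL A B Q0 Q R N k * Φ k j)
        + if j = k + 1 then wtr (ricX A B Q0 Q R N (k + 1)) V 1 else 0 := by
  by_cases hj : j = k + 1
  · subst hj
    rw [hr.state_self, hr.state_eq_zero (Nat.lt_succ_self k), hr.causal k _ (Nat.lt_succ_self k),
      if_pos rfl, Matrix.mul_zero, sub_zero, wtr_zero, wtr_zero', wtr_zero, wtr_zero']
    ring
  · rw [hr.step, if_neg hj, if_neg hj, add_zero, add_zero]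
    simp only [wtr]
    rw [← add_assoc, ← Matrix.trace_add, ← Matrix.trace_add, ← Matrix.trace_add, ← Matrix.add_mul,
      ← Matrix.add_mul, ← Matrix.add_mul, ricX_step A B N hQ0 hQ hR hk]

/-- The part of the cost that no control law can influence. -/
noncomputable def baseCost (A : Matrix (Idx n) (Idx n) ℝ) (B : Matrix (Idx n) (Idx m) ℝ)
    (Q0 Q : Matrix (Idx n) (Idx n) ℝ) (R : Matrix (Idx m) (Idx m) ℝ) (N : ℕ)
    (P0 W : Matrix (Idx n) (Idx n) ℝ) : ℝ :=
  ∑ j ∈ Finset.range (N + 1),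
    (wtr (ricX A B Q0 Q R N 0) (noiseCov P0 W (j + 1)) (if j = 0 then 1 else 0)
      + ∑ k ∈ Finset.range N,
        if j = k + 1 then wtr (ricX A B Q0 Q R N (k + 1)) (noiseCov P0 W (j + 1)) 1 else 0)

/-- The excess cost at time `k` due to the `j`-th disturbance. -/
noncomputable def excess (A : Matrix (Idx n) (Idx n) ℝ) (B : Matrix (Idx n) (Idx m) ℝ)
    (Q0 Q : Matrix (Idx n) (Idx n) ℝ) (R : Matrix (Idx m) (Idx m) ℝ) (N : ℕ)
    (P0 W : Matrix (Idx n) (Idx n) ℝ) (Γ : ℕ → ℕ → Matrix (Idx m) (Idx n) ℝ)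
    (Φ : ℕ → ℕ → Matrix (Idx n) (Idx n) ℝ) (k j : ℕ) : ℝ :=
  wtr (ricH A B Q0 Q R N k) (noiseCov P0 W (j + 1)) (Γ k j - ricL A B Q0 Q R N k * Φ k j)

theorem cost_eq_base_add_excess (hQ0 : Q0.PosSemidef) (hQ : Q.PosSemidef) (hR : R.PosDef)
    (h : IsNoise μ P0 W x0 w) (hr : IsResponse A B Γ Φ) (K : Law n m)
    (hu : ∀ x0 w k, input A B K x0 w k = ∑ j ∈ Finset.range (k + 1), Γ k j *ᵥ drive x0 w j) :
    cost A B Q0 Q R N μ x0 w K = baseCost A B Q0 Q R N P0 W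
      + ∑ j ∈ Finset.range (N + 1), ∑ k ∈ Finset.range N, excess A B Q0 Q R N P0 W Γ Φ k j := by
  rw [cost_eq_sum_wtr h hr K hu, baseCost, ← Finset.sum_add_distrib]
  refine Finset.sum_congr rfl fun j _ => ?_
  -- Stopping at `p` with terminal weight `X(p)` makes the sum telescope; at `p = N` that weight is
  -- `Q0`.
  have key : ∀ p ≤ N, wtr (ricX A B Q0 Q R N p) (noiseCov P0 W (j + 1)) (Φ p j)
      + ∑ k ∈ Finset.range p, (wtr Q (noiseCov P0 W (j + 1)) (Φ k j)
        + wtr R (noiseCov P0 W (j + 1)) (Γ k j))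
      = wtr (ricX A B Q0 Q R N 0) (noiseCov P0 W (j + 1)) (Φ 0 j)
        + (∑ k ∈ Finset.range p,
          if j = k + 1 then wtr (ricX A B Q0 Q R N (k + 1)) (noiseCov P0 W (j + 1)) 1 else 0)
        + ∑ k ∈ Finset.range p, excess A B Q0 Q R N P0 W Γ Φ k j := by
    intro p hp
    induction p with
    | zero => simp
    | succ p ih =>
      have h1 := ih (by omega)
      have h2 := wtr_step hQ0 hQ hR hr (noiseCov P0 W (j + 1)) j (k := p) (N := N) (by omega)
      rw [Finset.sum_range_succ, Finset.sum_range_succ, Finset.sum_range_succ, excess]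
      linarith
  have hN := key N le_rfl
  rw [hr.init] at hN
  rw [← hN, ricX, Nat.sub_self, riccatiRev]

/-- Splits off the delays 0 and 1, where sparsity binds. The disturbance `j = N` arrives after the
last input, and `j = N - 1` meets only one. -/
theorem sum_near_diagonal (N : ℕ) (e : ℕ → ℕ → ℝ) (he : ∀ k j, k < j → e k j = 0) :
    ∑ j ∈ Finset.range (N + 1), ∑ k ∈ Finset.range N, e k j
      = ∑ j ∈ Finset.range N, (e j j + if j + 1 < N then e (j + 1) j else 0)
        + ∑ j ∈ Finset.range N, ∑ k ∈ Finset.range N, if j + 2 ≤ k then e k j else 0 := by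
  rw [Finset.sum_range_succ, Finset.sum_eq_zero (f := fun k => e k N)
    fun k hk => he k N (Finset.mem_range.1 hk), add_zero, ← Finset.sum_add_distrib]
  refine Finset.sum_congr rfl fun j hj => ?_
  have h : ∀ k, e k j = (if k = j then e k j else 0) + (if k = j + 1 then e k j else 0)
      + if j + 2 ≤ k then e k j else 0 := by
    intro k
    rcases lt_or_ge k j with hk | hk
    · simp [he k j hk]
    · have : k = j ∨ k = j + 1 ∨ j + 2 ≤ k := by omega
      rcases this with rfl | rfl | hk'
      · simp
      · simp
      · rw [if_neg (by omega), if_neg (by omega), if_pos hk']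
        simp
  rw [Finset.sum_congr rfl fun k _ => h k, Finset.sum_add_distrib, Finset.sum_add_distrib,
    Finset.sum_ite_eq', Finset.sum_ite_eq', if_pos hj]
  simp only [Finset.mem_range]

/-- The cost of the responses at times `j` and `j + 1 < N` to the `j`-th disturbance. -/
noncomputable def nearCost (A : Matrix (Idx n) (Idx n) ℝ) (B : Matrix (Idx n) (Idx m) ℝ)
    (Q0 Q : Matrix (Idx n) (Idx n) ℝ) (R : Matrix (Idx m) (Idx m) ℝ) (N : ℕ)
    (P0 W : Matrix (Idx n) (Idx n) ℝ) (j : ℕ) (F M : Matrix (Idx m) (Idx n) ℝ) : ℝ :=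
  wtr (ricH A B Q0 Q R N j) (noiseCov P0 W (j + 1)) (F - ricL A B Q0 Q R N j)
    + if j + 1 < N then wtr (ricH A B Q0 Q R N (j + 1)) (noiseCov P0 W (j + 1))
        (M - ricL A B Q0 Q R N (j + 1) * (A + B * F)) else 0

theorem cost_eq_nearCost (hQ0 : Q0.PosSemidef) (hQ : Q.PosSemidef) (hR : R.PosDef)
    (h : IsNoise μ P0 W x0 w) (hr : IsResponse A B Γ Φ) (K : Law n m)
    (hu : ∀ x0 w k, input A B K x0 w k = ∑ j ∈ Finset.range (k + 1), Γ k j *ᵥ drive x0 w j) :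
    cost A B Q0 Q R N μ x0 w K = baseCost A B Q0 Q R N P0 W
      + (∑ j ∈ Finset.range N, nearCost A B Q0 Q R N P0 W j (Γ j j) (Γ (j + 1) j)
        + ∑ j ∈ Finset.range N, ∑ k ∈ Finset.range N,
            if j + 2 ≤ k then excess A B Q0 Q R N P0 W Γ Φ k j else 0) := by
  rw [cost_eq_base_add_excess hQ0 hQ hR h hr K hu, sum_near_diagonal]
  · simp only [excess, nearCost, hr.state_self, hr.state_succ_self, Matrix.mul_one]
  · intro k j hkj
    rw [excess, hr.state_eq_zero hkj, hr.causal k j hkj, Matrix.mul_zero, sub_zero, wtr_zero']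

theorem nearCost_eq_stageCost {j : ℕ} (hj : j + 1 < N) (F M : Matrix (Idx m) (Idx n) ℝ) :
    nearCost A B Q0 Q R N P0 W j F M
      = stageCost A B (noiseCov P0 W (j + 1)) (ricH A B Q0 Q R N j) (ricH A B Q0 Q R N (j + 1))
          (ricL A B Q0 Q R N j) (ricL A B Q0 Q R N (j + 1)) F M := by
  rw [nearCost, if_pos hj, stageCost]

theorem nearCost_last {j : ℕ} (hj : ¬ j + 1 < N) (F M : Matrix (Idx m) (Idx n) ℝ) :
    nearCost A B Q0 Q R N P0 W j F M
      = wtr (ricH A B Q0 Q R N j) (noiseCov P0 W (j + 1)) (F - ricL A B Q0 Q R N j) := by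
  rw [nearCost, if_neg hj, add_zero]

theorem exists_nearCost_min (hQ0 : Q0.PosSemidef) (hQ : Q.PosSemidef) (hR : R.PosDef) {j : ℕ}
    (hV : (noiseCov P0 W (j + 1)).PosSemidef) :
    ∃ F M : Matrix (Idx m) (Idx n) ℝ, BlockDiag F ∧ BlockTridiag M ∧ ∀ F' M', BlockDiag F' →
      BlockTridiag M' →
      nearCost A B Q0 Q R N P0 W j F M ≤ nearCost A B Q0 Q R N P0 W j F' M' := by
  have hH := fun k => (ricH_posDef A B N hQ0 hQ hR k).posSemidef
  have hVt := transpose_eq_of_posSemidef hV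
  by_cases hj : j + 1 < N
  · obtain ⟨v, hv, hmin⟩ := exists_masked_lsq_min
      (stageP_posSemidef hV (hH j) (hH (j + 1))) (stageT B (ricL A B Q0 Q R N (j + 1)))
      (stageY A (ricL A B Q0 Q R N j) (ricL A B Q0 Q R N (j + 1))) (SD n m)
    obtain ⟨F, M, rfl⟩ := exists_eq_vecD v
    obtain ⟨hF, hM⟩ := (vecD_vanishes_iff F M).1 hv
    refine ⟨F, M, hF, hM, fun F' M' hF' hM' => ?_⟩
    have := hmin _ ((vecD_vanishes_iff F' M').2 ⟨hF', hM'⟩)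
    rwa [lsq_stage A B hVt, lsq_stage A B hVt, ← nearCost_eq_stageCost hj,
      ← nearCost_eq_stageCost hj] at this
  -- Without a following input in the horizon, `M` does not enter and may be taken to be 0.
  · obtain ⟨v, hv, hmin⟩ := exists_masked_lsq_min (hV.kronecker (hH j)) 1
      (Matrix.vec (ricL A B Q0 Q R N j)) (SF n m)
    obtain ⟨F, rfl⟩ := Matrix.vec_bijective.surjective v
    refine ⟨F, 0, (vec_vanishes_iff_blockDiag F).1 hv, fun _ _ _ => rfl, fun F' M' hF' _ => ?_⟩
    have := hmin _ ((vec_vanishes_iff_blockDiag F').2 hF')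
    rwa [lsq_single_stage hVt, lsq_single_stage hVt, ← nearCost_last hj F 0,
      ← nearCost_last hj F' M'] at this

/-- Input response with the values `F j` and `M j` at times `j` and `j + 1`, and the centralized
feedback `L` from then on. -/
def delayedInput (L : ℕ → Matrix (Idx m) (Idx n) ℝ) (F M : ℕ → Matrix (Idx m) (Idx n) ℝ)
    (k j : ℕ) (X : Matrix (Idx n) (Idx n) ℝ) : Matrix (Idx m) (Idx n) ℝ :=
  if k < j then 0 else if k = j then F j else if k = j + 1 then M j else L k * X

/-- The state response that goes with `delayedInput`. -/
def delayedState (A : Matrix (Idx n) (Idx n) ℝ) (B : Matrix (Idx n) (Idx m) ℝ)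
    (L F M : ℕ → Matrix (Idx m) (Idx n) ℝ) (j : ℕ) : ℕ → Matrix (Idx n) (Idx n) ℝ
  | 0 => if j = 0 then 1 else 0
  | k + 1 => A * delayedState A B L F M j k
      + B * delayedInput L F M k j (delayedState A B L F M j k) + if j = k + 1 then 1 else 0

theorem isResponse_delayed (L F M : ℕ → Matrix (Idx m) (Idx n) ℝ) :
    IsResponse A B (fun k j => delayedInput L F M k j (delayedState A B L F M j k))
      fun k j => delayedState A B L F M j k where
  init _ := rfl
  step _ _ := rfl
  causal _ _ hkj := if_pos hkj

/-- The cost of an admissible law bounds the cost of the near responses. -/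
theorem nearCost_le_cost (hQ0 : Q0.PosSemidef) (hQ : Q.PosSemidef) (hR : R.PosDef)
    (h : IsNoise μ P0 W x0 w) (hW : W.PosSemidef) (K : Law n m) :
    baseCost A B Q0 Q R N P0 W + ∑ j ∈ Finset.range N,
        nearCost A B Q0 Q R N P0 W j (gainF K j) (gainM A B K (j + 1))
      ≤ cost A B Q0 Q R N μ x0 w K := by
  rw [cost_eq_nearCost hQ0 hQ hR h (isResponse_of_law A B K) K (input_eq_response K)]
  simp only [inputResponse_self, inputResponse_succ_self]
  have : 0 ≤ ∑ j ∈ Finset.range N, ∑ k ∈ Finset.range N,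
      if j + 2 ≤ k then excess A B Q0 Q R N P0 W (inputResponse A B K)
        (fun k j => stateResponse A B K j k) k j else 0 := by
    refine Finset.sum_nonneg fun j _ => Finset.sum_nonneg fun k _ => ?_
    split_ifs
    · exact wtr_nonneg (ricH_posDef A B N hQ0 hQ hR k).posSemidef (h.noiseCov_posSemidef hW j) _
    · exact le_rfl
  linarith

/-- Any admissible near responses are attained with no further cost. -/
theorem exists_admissible_cost_eq (hA : BlockTridiag A) (hB : BlockDiag B) (hQ0 : Q0.PosSemidef)
    (hQ : Q.PosSemidef) (hR : R.PosDef) (h : IsNoise μ P0 W x0 w)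
    {F M : ℕ → Matrix (Idx m) (Idx n) ℝ} (hF : ∀ j, BlockDiag (F j))
    (hM : ∀ j, BlockTridiag (M j)) :
    ∃ K : Law n m, Admissible K ∧ cost A B Q0 Q R N μ x0 w K
      = baseCost A B Q0 Q R N P0 W
        + ∑ j ∈ Finset.range N, nearCost A B Q0 Q R N P0 W j (F j) (M j) := by
  have hr := isResponse_delayed (A := A) (B := B) (ricL A B Q0 Q R N) F M
  set Γ : ℕ → ℕ → Matrix (Idx m) (Idx n) ℝ := fun k j => delayedInput (ricL A B Q0 Q R N) F M k j
    (delayedState A B (ricL A B Q0 Q R N) F M j k) with hΓ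
  have hΓF : ∀ k, Γ k k = F k := fun k => by simp [hΓ, delayedInput]
  have hΓM : ∀ k, Γ (k + 1) k = M k := fun k => by simp [hΓ, delayedInput]
  refine ⟨realize A B Γ, admissible_realize hr.causal hA hB (fun k => hΓF k ▸ hF k)
    (fun k => hΓM k ▸ hM k), ?_⟩
  rw [cost_eq_nearCost hQ0 hQ hR h hr _ (input_realize hr.causal)]
  simp only [hΓF, hΓM]
  rw [Finset.sum_eq_zero (f := fun j => ∑ k ∈ Finset.range N, _), add_zero]
  refine fun j _ => Finset.sum_eq_zero fun k _ => ?_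
  split_ifs with hjk
  -- From delay 2 on, the chosen response is the centralized feedback, so the excess vanishes.
  · have : Γ k j = ricL A B Q0 Q R N k * delayedState A B (ricL A B Q0 Q R N) F M j k := by
      simp only [hΓ, delayedInput]
      rw [if_neg (by omega), if_neg (by omega), if_neg (by omega)]
    rw [excess, this, sub_self, wtr_zero']
  · rfl

/-- An optimal law exists, and its near responses to each disturbance are optimal. -/
theorem exists_isOptimal_and_nearCost_min (hA : BlockTridiag A) (hB : BlockDiag B)
    (hQ0 : Q0.PosSemidef) (hQ : Q.PosSemidef) (hR : R.PosDef) (h : IsNoise μ P0 W x0 w)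
    (hW : W.PosSemidef) :
    (∃ K : Law n m, IsOptimal A B Q0 Q R N μ x0 w K) ∧
    ∀ K : Law n m, IsOptimal A B Q0 Q R N μ x0 w K → ∀ j < N, ∀ F M, BlockDiag F → BlockTridiag M →
      nearCost A B Q0 Q R N P0 W j (gainF K j) (gainM A B K (j + 1))
        ≤ nearCost A B Q0 Q R N P0 W j F M := by
  choose F M hF hM hmin using fun j => exists_nearCost_min (A := A) (B := B) (N := N) hQ0 hQ hR
    (h.noiseCov_posSemidef hW j)
  obtain ⟨K₀, hK₀, hc⟩ := exists_admissible_cost_eq (N := N) hA hB hQ0 hQ hR h hF hM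
  have hle : ∀ K : Law n m, Admissible K → ∀ j, nearCost A B Q0 Q R N P0 W j (F j) (M j)
      ≤ nearCost A B Q0 Q R N P0 W j (gainF K j) (gainM A B K (j + 1)) := fun K hK j =>
    hmin j _ _ (hK.blockDiag_gainF j) (hK.blockTridiag_gainM hA hB j)
  refine ⟨⟨K₀, hK₀, fun K hK => ?_⟩, fun K hK j hj F' M' hF' hM' => ?_⟩
  · rw [hc]
    refine le_trans ?_ (nearCost_le_cost hQ0 hQ hR h hW K)
    gcongr with j
    exact hle K hK j
  · refine le_trans ?_ (hmin j F' M' hF' hM')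
    have h1 := nearCost_le_cost (N := N) (A := A) (B := B) hQ0 hQ hR h hW K
    have h2 := hK.2 K₀ hK₀
    -- Optimality of `K` against `K₀` bounds the left sum above and stagewise minimality bounds it
    -- below; equal sums of termwise ordered quantities force equality in every stage.
    have h3 : ∑ j ∈ Finset.range N,
        nearCost A B Q0 Q R N P0 W j (gainF K j) (gainM A B K (j + 1))
        = ∑ j ∈ Finset.range N, nearCost A B Q0 Q R N P0 W j (F j) (M j) :=
      le_antisymm (by linarith) (Finset.sum_le_sum fun j _ => hle K hK.1 j)
    exact ((Finset.sum_eq_sum_iff_of_le fun j _ => hle K hK.1 j).1 h3.symm j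
      (Finset.mem_range.2 hj)).ge

/-! ### Identification of the normal equations with `Y_k` and `b_k`. -/

theorem noiseCov_posDef (hW : W.PosDef) {k : ℕ} (hP0 : k = 1 → P0.PosDef) :
    (noiseCov P0 W k).PosDef := by
  rw [noiseCov]
  split_ifs with hk
  · exact hP0 hk
  · exact hW

theorem Ymat_eq (hQ0 : Q0.PosSemidef) (hQ : Q.PosSemidef) (hR : R.PosDef) {k : ℕ}
    (hV : (noiseCov P0 W k)ᵀ = noiseCov P0 W k) :
    Ymat A B Q0 Q R N P0 W k = (stageT B (ricL A B Q0 Q R N k))ᵀ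
      * stageP (noiseCov P0 W k) (ricH A B Q0 Q R N (k - 1)) (ricH A B Q0 Q R N k)
      * stageT B (ricL A B Q0 Q R N k) := by
  rw [stage_normal_matrix B _ hV _
    (transpose_eq_of_posSemidef (ricH_posDef A B N hQ0 hQ hR k).posSemidef)]
  rfl

theorem bvec_eq (k : ℕ) : bvec A B Q0 Q R N P0 W k = ((stageT B (ricL A B Q0 Q R N k))ᵀ
      * stageP (noiseCov P0 W k) (ricH A B Q0 Q R N (k - 1)) (ricH A B Q0 Q R N k))
      *ᵥ stageY A (ricL A B Q0 Q R N (k - 1)) (ricL A B Q0 Q R N k) := by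
  rw [stage_normal_vector]
  rfl

theorem Ymat_posDef (hQ0 : Q0.PosSemidef) (hQ : Q.PosSemidef) (hR : R.PosDef) {k : ℕ}
    (hV : (noiseCov P0 W k).PosDef) : (Ymat A B Q0 Q R N P0 W k).PosDef := by
  rw [Ymat_eq hQ0 hQ hR (transpose_eq_of_posSemidef hV.posSemidef)]
  exact stage_posDef B _ hV (ricH_posDef A B N hQ0 hQ hR _) (ricH_posDef A B N hQ0 hQ hR _)

theorem Ylast_posDef (hQ0 : Q0.PosSemidef) (hQ : Q.PosSemidef) (hR : R.PosDef)
    (hV : (noiseCov P0 W N).PosDef) : (Ylast A B Q0 Q R N P0 W).PosDef :=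
  hV.kronecker (ricH_posDef A B N hQ0 hQ hR _)

theorem subVec_vecD_eq_sol (hQ0 : Q0.PosSemidef) (hQ : Q.PosSemidef) (hR : R.PosDef) {j : ℕ}
    (hj : j + 1 < N) (hV : (noiseCov P0 W (j + 1)).PosDef) {F M : Matrix (Idx m) (Idx n) ℝ}
    (hF : BlockDiag F) (hM : BlockTridiag M)
    (hmin : ∀ F' M', BlockDiag F' → BlockTridiag M' →
      nearCost A B Q0 Q R N P0 W j F M ≤ nearCost A B Q0 Q R N P0 W j F' M') :
    subVec (SD n m) (vecD (Matrix.fromCols F M)) = sol A B Q0 Q R N P0 W (j + 1) := by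
  have hVt := transpose_eq_of_posSemidef hV.posSemidef
  have hH := fun k => (ricH_posDef A B N hQ0 hQ hR k)
  rw [sol, Ymat_eq hQ0 hQ hR hVt, bvec_eq, Nat.add_sub_cancel]
  refine subVec_eq_of_masked_lsq_min
    (stageP_posSemidef hV.posSemidef (hH j).posSemidef (hH (j + 1)).posSemidef) (SD n m)
    (stage_posDef B _ hV (hH j) (hH (j + 1))) ((vecD_vanishes_iff F M).2 ⟨hF, hM⟩) fun v hv => ?_
  obtain ⟨F', M', rfl⟩ := exists_eq_vecD v
  obtain ⟨hF', hM'⟩ := (vecD_vanishes_iff F' M').1 hv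
  rw [lsq_stage A B hVt, lsq_stage A B hVt, ← nearCost_eq_stageCost hj, ← nearCost_eq_stageCost hj]
  exact hmin F' M' hF' hM'

theorem subVec_vec_eq_solLast (hQ0 : Q0.PosSemidef) (hQ : Q.PosSemidef) (hR : R.PosDef)
    (hN : 1 ≤ N) (hV : (noiseCov P0 W N).PosDef) {F M : Matrix (Idx m) (Idx n) ℝ}
    (hF : BlockDiag F) (hmin : ∀ F' M', BlockDiag F' → BlockTridiag M' →
      nearCost A B Q0 Q R N P0 W (N - 1) F M ≤ nearCost A B Q0 Q R N P0 W (N - 1) F' M') :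
    subVec (SF n m) (Matrix.vec F) = solLast A B Q0 Q R N P0 W := by
  have hVt := transpose_eq_of_posSemidef hV.posSemidef
  have hY := Ylast_posDef (A := A) (B := B) hQ0 hQ hR hV
  have hj : ¬ N - 1 + 1 < N := by omega
  -- In the last stage the design matrix is the identity, and `M` is a dummy argument.
  have hlsq : ∀ F M : Matrix (Idx m) (Idx n) ℝ, lsq (Ylast A B Q0 Q R N P0 W) 1
      (Matrix.vec (ricL A B Q0 Q R N (N - 1))) (Matrix.vec F)
      = nearCost A B Q0 Q R N P0 W (N - 1) F M := fun F M => by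
    rw [nearCost_last hj, Ylast, lsq_single_stage hVt, Nat.sub_add_cancel hN]
  have := subVec_eq_of_masked_lsq_min (T := 1) (y := Matrix.vec (ricL A B Q0 Q R N (N - 1)))
    hY.posSemidef (SF n m) (by simpa using hY) ((vec_vanishes_iff_blockDiag F).2 hF) fun v hv => by
      obtain ⟨F', rfl⟩ := Matrix.vec_bijective.surjective v
      rw [hlsq F M, hlsq F' 0]
      exact hmin F' 0 ((vec_vanishes_iff_blockDiag F').1 hv) fun _ _ _ => rfl
  rw [this, solLast, blast, Matrix.transpose_one, Matrix.one_mul, Matrix.mul_one]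

end Cost

end DelayedLQ

theorem theorem3 {Ω : Type*} [MeasurableSpace Ω] (μ : MeasureTheory.Measure Ω)
    [MeasureTheory.IsProbabilityMeasure μ]
    (n m : Fin 3 → ℕ) (N : ℕ) (hN : 1 ≤ N)
    (A : Matrix (DelayedLQ.Idx n) (DelayedLQ.Idx n) ℝ)
    (B : Matrix (DelayedLQ.Idx n) (DelayedLQ.Idx m) ℝ)
    (hA : DelayedLQ.BlockTridiag A) (hB : DelayedLQ.BlockDiag B)
    (Q0 Q : Matrix (DelayedLQ.Idx n) (DelayedLQ.Idx n) ℝ)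
    (R : Matrix (DelayedLQ.Idx m) (DelayedLQ.Idx m) ℝ)
    (hQ0 : Q0.PosSemidef) (hQ : Q.PosSemidef) (hR : R.PosDef)
    (P0 W : Matrix (DelayedLQ.Idx n) (DelayedLQ.Idx n) ℝ) (hW : W.PosDef)
    (x0 : Ω → DelayedLQ.Idx n → ℝ) (w : ℕ → Ω → DelayedLQ.Idx n → ℝ)
    (hnoise : DelayedLQ.IsNoise μ P0 W x0 w) :
    -- an optimal admissible law exists
    (∃ K : DelayedLQ.Law n m, DelayedLQ.IsOptimal A B Q0 Q R N μ x0 w K) ∧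
    -- the systems that define the gains are nonsingular
    (∀ k, 1 ≤ k → k ≤ N - 1 → (k = 1 → P0.PosDef) →
      IsUnit (DelayedLQ.subMat (DelayedLQ.SD n m)
        (DelayedLQ.Ymat A B Q0 Q R N P0 W k)).det) ∧
    ((N = 1 → P0.PosDef) →
      IsUnit (DelayedLQ.subMat (DelayedLQ.SF n m)
        (DelayedLQ.Ylast A B Q0 Q R N P0 W)).det) ∧
    -- the gains of every optimal law
    (∀ K : DelayedLQ.Law n m, DelayedLQ.IsOptimal A B Q0 Q R N μ x0 w K →
      (∀ k, 1 ≤ k → k ≤ N - 1 → (k = 1 → P0.PosDef) →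
        DelayedLQ.subVec (DelayedLQ.SD n m)
            (DelayedLQ.vecD (Matrix.fromCols (DelayedLQ.gainF K (k - 1))
              (DelayedLQ.gainM A B K k)))
          = DelayedLQ.sol A B Q0 Q R N P0 W k ∧
        DelayedLQ.subVec (DelayedLQ.SF n m) (Matrix.vec (DelayedLQ.gainF K (k - 1)))
          = DelayedLQ.firstBlock (DelayedLQ.sol A B Q0 Q R N P0 W k) ∧
        DelayedLQ.subVec (DelayedLQ.SM n m) (Matrix.vec (DelayedLQ.gainM A B K k))
          = DelayedLQ.secondBlock (DelayedLQ.sol A B Q0 Q R N P0 W k) ∧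
        DelayedLQ.BlockDiag (DelayedLQ.gainF K (k - 1)) ∧
        DelayedLQ.BlockTridiag (DelayedLQ.gainM A B K k)) ∧
      ((N = 1 → P0.PosDef) →
        DelayedLQ.subVec (DelayedLQ.SF n m) (Matrix.vec (DelayedLQ.gainF K (N - 1)))
          = DelayedLQ.solLast A B Q0 Q R N P0 W ∧
        DelayedLQ.BlockDiag (DelayedLQ.gainF K (N - 1)))) := by
  obtain ⟨hex, hopt⟩ := DelayedLQ.exists_isOptimal_and_nearCost_min (N := N) hA hB hQ0 hQ hR hnoise
    hW.posSemidef
  refine ⟨hex, fun k _ _ hP => DelayedLQ.isUnit_det_subMat _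
      (DelayedLQ.Ymat_posDef hQ0 hQ hR (DelayedLQ.noiseCov_posDef hW hP)),
    fun hP => DelayedLQ.isUnit_det_subMat _
      (DelayedLQ.Ylast_posDef hQ0 hQ hR (DelayedLQ.noiseCov_posDef hW hP)),
    fun K hK => ⟨fun k hk hkN hP => ?_, fun hP => ⟨?_, hK.1.blockDiag_gainF _⟩⟩⟩
  -- The system with index `k` belongs to the disturbance `j = k - 1`, that is `w(k-2)`, or `x(0)`
  -- when `k = 1`.
  · obtain ⟨j, rfl⟩ : ∃ j, k = j + 1 := ⟨k - 1, by omega⟩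
    have hM := hK.1.blockTridiag_gainM hA hB j
    have hsol := DelayedLQ.subVec_vecD_eq_sol hQ0 hQ hR (by omega)
      (DelayedLQ.noiseCov_posDef hW hP) (hK.1.blockDiag_gainF j) hM (hopt K hK j (by omega))
    rw [Nat.add_sub_cancel]
    refine ⟨hsol, ?_, ?_, hK.1.blockDiag_gainF j, hM⟩
    · rw [← hsol, DelayedLQ.vecD_fromCols]
      rfl
    · rw [← hsol, DelayedLQ.vecD_fromCols]
      rfl
  · exact DelayedLQ.subVec_vec_eq_solLast hQ0 hQ hR hN (DelayedLQ.noiseCov_posDef hW hP)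
      (hK.1.blockDiag_gainF _) (hopt K hK (N - 1) (by omega))
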